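/- Let $0<L\le\infty$, $I=(-L,L)$, $H=L^2(I)$ (real valued) with inner product $(u,v)=\int_I uv\,dx$ and norm $|\cdot|$. Give $H^1(I)$ the norm $\|u\|^2=|u|^2+|u_x|^2$, and let $V$ be $H^1_0(I)$ or $H^1_N(I)$, where $H^1_N(I)$ is the closure in $H^1(I)$ of the set of those $u\in H^1(I)$ whose derivative $u_x$ is continuous on $\overline I$ with $u_x=0$ at the endpoints of $I$ (if $L=\infty$ there are none). Let $V^*$ be the dual of $V$, with $V\subset H\subset V^*$. Let $\kappa\ge 0$ and let $\mathcal A:V\to V^*$ be given by $\langle \mathcal Au,v\rangle=(u_x,v_x)+\kappa(u,v)$ (so $\mathcal A=-\partial_x^2$ for $\kappa=0$; a term with $\kappa>0$ makes the form coercive on $V$). Let $\lambda>0$, $T>0$, and let $f:[0,T]\times V\to V^*$ be Lipschitz continuous with constant $K$ from $L^2(0,T;V)$ into $L^2(0,T;V^*)$, that is, $\eta\mapsto f(\cdot,\eta(\cdot))$ maps $L^2(0,T;V)$ into $L^2(0,T;V^*)$ and $\|f(\cdot,\eta_1)-f(\cdot,\eta_2)\|_{L^2(0,T;V^*)}\le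 K\|\eta_1-\eta_2\|_{L^2(0,T;V)}$. Put $g=f(\cdot,0)$. Then for all $u_0\in V$, $v_0\in H$ the problem $$\eta''+\lambda\mathcal A\eta'+\mathcal A\eta=f(t,\eta),\qquad \eta(0)=u_0,\quad \eta'(0)=v_0,$$ has a unique weak solution, that is, a unique $\eta\in L^2(0,T;V)$ with distributional time derivatives $\eta'\in L^2(0,T;V)$, $\eta''\in L^2(0,T;V^*)$, which satisfies the equation in $V^*$ for a.e. $t\in(0,T)$ and attains the initial values in $V$ and in $H$ respectively. After modification on a set of measure zero, $$\eta\in C([0,T];V),\qquad \eta'\in C([0,T];H),\qquad \eta''\in L^2(0,T;V^*),$$ and for all $t\in[0,T]$ $$|\eta'(t)|^2+\|\eta(t)\|^2+\int_0^t\|\eta'(s)\|^2\,ds\le C\left(\|u_0\|^2+|v_0|^2+\|g\|^2_{L^2(0,T;V^*)}\right),$$ where $C$ depends only on $T$, $\lambda$, $K$ and $\kappa$. Point forcing is covered: for every $x_0\in\overline I$, the evaluation $\delta_{x_0}:v\mapsto v(x_0)$ of the continuous representative on $\overline I$ belongs to $V^*$, and $f(t,\eta)=\delta(x-x_0)\sin\eta$,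 that is $\langle f(t,w),v\rangle=\sin(w(x_0))\,v(x_0)$, is Lipschitz continuous in the above sense, with a constant that does not depend on $T$. -/

import Mathlib

open MeasureTheory Filter Topology Set
open scoped NNReal ENNReal ContDiff

namespace SineGordon

noncomputable section

/-- Real test functions on a set `I ⊆ ℝ`: smooth, with compact support contained in `I`. -/
structure IsTestFunction (I : Set ℝ) (φ : ℝ → ℝ) : Prop where
  smooth : ContDiff ℝ ∞ φ
  compact : HasCompactSupport φ
  support : tsupport φ ⊆ I

/-- `w` is the derivative of `u` on `I` in the sense of distributions with values in `X`:
`∫_I φ' u = - ∫_I φ w` for every test function `φ` on `I`. -/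
def HasWeakDeriv {X : Type*} [NormedAddCommGroup X] [NormedSpace ℝ X]
    (I : Set ℝ) (u w : ℝ → X) : Prop :=
  ∀ φ : ℝ → ℝ, IsTestFunction I φ →
    ∫ x in I, deriv φ x • u x = - ∫ x in I, φ x • w x

/-- The open interval `(-L, L)`; `L = ⊤` gives the whole line. -/
def interval (L : EReal) : Set ℝ := {x : ℝ | -L < (x : EReal) ∧ (x : EReal) < L}

/-- `H = L²(-L, L)`, real valued. -/
abbrev H (L : EReal) : Type := Lp ℝ 2 (volume.restrict (interval L))

/-- The Hilbert sum `H × H`, in which `u ∈ H¹(-L, L)` is represented by the pair `(u, u_x)`. -/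
abbrev HxH (L : EReal) : Type := WithLp 2 (H L × H L)

theorem IsTestFunction.memLp {I : Set ℝ} {φ : ℝ → ℝ} (h : IsTestFunction I φ) (μ : Measure ℝ)
    [IsFiniteMeasureOnCompacts μ] : MemLp φ 2 μ :=
  h.smooth.continuous.memLp_of_hasCompactSupport h.compact

theorem IsTestFunction.memLp_deriv {I : Set ℝ} {φ : ℝ → ℝ} (h : IsTestFunction I φ)
    (μ : Measure ℝ) [IsFiniteMeasureOnCompacts μ] : MemLp (deriv φ) 2 μ :=
  (h.smooth.continuous_deriv (by simp)).memLp_of_hasCompactSupport h.compact.deriv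

theorem IsTestFunction.integrable_smul {L : EReal} {φ : ℝ → ℝ} (h : IsTestFunction (interval L) φ)
    (w : H L) : Integrable (fun x => φ x • w x) (volume.restrict (interval L)) :=
  (h.memLp _).integrable_mul (Lp.memLp w)

theorem IsTestFunction.integrable_deriv_smul {L : EReal} {φ : ℝ → ℝ}
    (h : IsTestFunction (interval L) φ) (u : H L) :
    Integrable (fun x => deriv φ x • u x) (volume.restrict (interval L)) :=
  (h.memLp_deriv _).integrable_mul (Lp.memLp u)

theorem isTestFunction_zero (I : Set ℝ) : IsTestFunction I 0 :=
  ⟨contDiff_const, HasCompactSupport.zero, by simp [tsupport]⟩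

theorem IsTestFunction.add {I : Set ℝ} {φ ψ : ℝ → ℝ} (h : IsTestFunction I φ)
    (k : IsTestFunction I ψ) : IsTestFunction I (φ + ψ) :=
  ⟨h.smooth.add k.smooth, h.compact.add k.compact,
    (tsupport_add φ ψ).trans (union_subset h.support k.support)⟩

theorem IsTestFunction.smul {I : Set ℝ} {φ : ℝ → ℝ} (h : IsTestFunction I φ) (c : ℝ) :
    IsTestFunction I (c • φ) :=
  ⟨h.smooth.const_smul c, h.compact.smul_left (f := fun _ => c),
    (tsupport_smul_subset_right (fun _ => c) φ).trans h.support⟩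

/-- The Sobolev space `H¹(-L, L)`, as the space of pairs `(u, u_x)`, where `u_x` is the weak
derivative of `u`, with inner product `((u, v)) = (u, v) + (u_x, v_x)`. -/
def H1 (L : EReal) : Submodule ℝ (HxH L) where
  carrier := {p | HasWeakDeriv (interval L) p.fst p.snd}
  zero_mem' := by
    intro φ _
    have h : ((0 : H L) : ℝ → ℝ) =ᵐ[volume.restrict (interval L)] 0 := Lp.coeFn_zero _ _ _
    have h1 : ∫ x in interval L, deriv φ x • (0 : H L) x = 0 := by
      rw [integral_congr_ae (g := fun _ => (0 : ℝ))]
      · simp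
      · filter_upwards [h] with x hx
        rw [hx, Pi.zero_apply, smul_zero]
    have h2 : ∫ x in interval L, φ x • (0 : H L) x = 0 := by
      rw [integral_congr_ae (g := fun _ => (0 : ℝ))]
      · simp
      · filter_upwards [h] with x hx
        rw [hx, Pi.zero_apply, smul_zero]
    change ∫ x in interval L, deriv φ x • (0 : H L) x = -∫ x in interval L, φ x • (0 : H L) x
    rw [h1, h2, neg_zero]
  add_mem' := by
    intro p q hp hq φ hφ
    change ∫ x in interval L, deriv φ x • (p.fst + q.fst : H L) x
      = -∫ x in interval L, φ x • (p.snd + q.snd : H L) x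
    have h1 : ∫ x in interval L, deriv φ x • (p.fst + q.fst : H L) x
        = (∫ x in interval L, deriv φ x • p.fst x) + ∫ x in interval L, deriv φ x • q.fst x := by
      rw [← integral_add (hφ.integrable_deriv_smul _) (hφ.integrable_deriv_smul _)]
      refine integral_congr_ae ?_
      filter_upwards [Lp.coeFn_add p.fst q.fst] with x hx
      rw [hx, Pi.add_apply, smul_add]
    have h2 : ∫ x in interval L, φ x • (p.snd + q.snd : H L) x
        = (∫ x in interval L, φ x • p.snd x) + ∫ x in interval L, φ x • q.snd x := by
      rw [← integral_add (hφ.integrable_smul _) (hφ.integrable_smul _)]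
      refine integral_congr_ae ?_
      filter_upwards [Lp.coeFn_add p.snd q.snd] with x hx
      rw [hx, Pi.add_apply, smul_add]
    rw [h1, h2, hp φ hφ, hq φ hφ, neg_add]
  smul_mem' := by
    intro c p hp φ hφ
    change ∫ x in interval L, deriv φ x • (c • p.fst : H L) x
      = -∫ x in interval L, φ x • (c • p.snd : H L) x
    have h1 : ∫ x in interval L, deriv φ x • (c • p.fst : H L) x
        = c • ∫ x in interval L, deriv φ x • p.fst x := by
      rw [← integral_smul]
      refine integral_congr_ae ?_
      filter_upwards [Lp.coeFn_smul c p.fst] with x hx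
      rw [hx, Pi.smul_apply, smul_comm]
    have h2 : ∫ x in interval L, φ x • (c • p.snd : H L) x
        = c • ∫ x in interval L, φ x • p.snd x := by
      rw [← integral_smul]
      refine integral_congr_ae ?_
      filter_upwards [Lp.coeFn_smul c p.snd] with x hx
      rw [hx, Pi.smul_apply, smul_comm]
    rw [h1, h2, hp φ hφ, smul_neg]

/-- The test functions on `(-L, L)`, each with its derivative, as elements of `H × H`. -/
def testPairs (L : EReal) : Submodule ℝ (HxH L) where
  carrier := {p | ∃ φ : ℝ → ℝ, IsTestFunction (interval L) φ ∧
    p.fst =ᵐ[volume.restrict (interval L)] φ ∧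
    p.snd =ᵐ[volume.restrict (interval L)] deriv φ}
  zero_mem' := by
    refine ⟨0, isTestFunction_zero _, Lp.coeFn_zero _ _ _, ?_⟩
    rw [deriv_zero]
    exact Lp.coeFn_zero _ _ _
  add_mem' := by
    rintro p q ⟨φ, hφ, h1, h2⟩ ⟨ψ, hψ, k1, k2⟩
    refine ⟨φ + ψ, hφ.add hψ, ?_, ?_⟩
    · exact (Lp.coeFn_add p.fst q.fst).trans (h1.add k1)
    · refine (Lp.coeFn_add p.snd q.snd).trans ((h2.add k2).trans (Eq.eventuallyEq ?_))
      funext x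
      exact (deriv_add (hφ.smooth.differentiable (by simp) x)
        (hψ.smooth.differentiable (by simp) x)).symm
  smul_mem' := by
    rintro c p ⟨φ, hφ, h1, h2⟩
    refine ⟨c • φ, hφ.smul c, ?_, ?_⟩
    · exact (Lp.coeFn_smul c p.fst).trans (h1.const_smul c)
    · refine (Lp.coeFn_smul c p.snd).trans ((h2.const_smul c).trans (Eq.eventuallyEq ?_))
      funext x
      exact (deriv_const_smul c (hφ.smooth.differentiable (by simp) x)).symm

/-- `H¹₀(-L, L)`: the closure of the test functions in the norm of `H¹`. -/
def H10 (L : EReal) : Submodule ℝ (HxH L) := (testPairs L).topologicalClosure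

/-- The functions `u ∈ H¹(-L, L)` whose derivative `u_x` is continuous up to the boundary and
satisfies the Neumann condition `u_x(±L) = 0` (for `L = ⊤` there is no boundary point). -/
def neumannPairs (L : EReal) : Submodule ℝ (HxH L) where
  carrier := {p | p ∈ H1 L ∧ ∃ d : ℝ → ℝ, ContinuousOn d (closure (interval L)) ∧
    p.snd =ᵐ[volume.restrict (interval L)] d ∧ ∀ x ∈ frontier (interval L), d x = 0}
  zero_mem' := ⟨zero_mem _, 0, continuousOn_const, Lp.coeFn_zero _ _ _, fun _ _ => rfl⟩
  add_mem' := by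
    rintro p q ⟨hp, d, hd, h1, h2⟩ ⟨hq, e, he, k1, k2⟩
    refine ⟨add_mem hp hq, d + e, hd.add he,
      (Lp.coeFn_add p.snd q.snd).trans (h1.add k1), fun x hx => ?_⟩
    simp [h2 x hx, k2 x hx]
  smul_mem' := by
    rintro c p ⟨hp, d, hd, h1, h2⟩
    refine ⟨Submodule.smul_mem _ c hp, c • d, hd.const_smul c,
      (Lp.coeFn_smul c p.snd).trans (h1.const_smul c), fun x hx => ?_⟩
    simp [h2 x hx]

/-- `H¹_N(-L, L)`, the Hilbert space of the Neumann problem: the condition `u_x(±L) = 0` is not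
stable under limits in `H¹`, so the completion, that is the closure in `H¹`, is taken. -/
def H1N (L : EReal) : Submodule ℝ (HxH L) := (neumannPairs L).topologicalClosure

section Triple

variable {L : EReal} (V : Submodule ℝ (HxH L))

/-- The embedding `V → H`, `u ↦ u`. -/
def toH : V →L[ℝ] H L := (WithLp.fstL 2 ℝ (H L) (H L)).comp V.subtypeL

/-- The spatial derivative `V → H`, `u ↦ u_x`. -/
def dx : V →L[ℝ] H L := (WithLp.sndL 2 ℝ (H L) (H L)).comp V.subtypeL

/-- The embedding `H → V*`: `⟨h, v⟩ = (h, v)`. -/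
def toDual : H L →L[ℝ] StrongDual ℝ V :=
  (innerSL ℝ (E := H L)).bilinearComp (ContinuousLinearMap.id ℝ (H L)) (toH V)

/-- The operator `A : V → V*`, `⟨A u, v⟩ = a(u, v) = (u_x, v_x) + κ (u, v)`. -/
def opA (κ : ℝ) : V →L[ℝ] StrongDual ℝ V :=
  (innerSL ℝ (E := H L)).bilinearComp (dx V) (dx V) +
    κ • (innerSL ℝ (E := H L)).bilinearComp (toH V) (toH V)

/-- `f : [0, T] × V → V*` is Lipschitz continuous with constant `K` from `L²(0, T; V)` into
`L²(0, T; V*)`: the map `u ↦ f(·, u(·))` sends the first space to the second and is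
`K`-Lipschitz for their norms. -/
structure IsLipschitzForcing (T : ℝ) (K : ℝ≥0) (f : ℝ → V → StrongDual ℝ V) : Prop where
  memLp : ∀ u : ℝ → V, MemLp u 2 (volume.restrict (Ioo 0 T)) →
    MemLp (fun t => f t (u t)) 2 (volume.restrict (Ioo 0 T))
  lipschitz : ∀ u v : ℝ → V, MemLp u 2 (volume.restrict (Ioo 0 T)) →
    MemLp v 2 (volume.restrict (Ioo 0 T)) →
    eLpNorm (fun t => f t (u t) - f t (v t)) 2 (volume.restrict (Ioo 0 T)) ≤
      K * eLpNorm (fun t => u t - v t) 2 (volume.restrict (Ioo 0 T))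

/-- `η` is a weak solution, with first and second time derivatives `η'` and `η''`, of
`η'' + lam A η' + A η = f(t, η)`, `η(0) = u₀`, `η'(0) = v₀`.  That is, `η, η' ∈ L²(0, T; V)` and
`η'' ∈ L²(0, T; V*)`, the derivatives being those of distributions on `(0, T)`, the equation holds
in `V*` for almost every `t`, and the initial values are attained as essential limits at `0+`, in
`V` and in `H` respectively. -/
structure IsWeakSolution (κ lam T : ℝ) (f : ℝ → V → StrongDual ℝ V) (u₀ : V) (v₀ : H L)
    (η η' : ℝ → V) (η'' : ℝ → StrongDual ℝ V) : Prop where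
  memLp : MemLp η 2 (volume.restrict (Ioo 0 T))
  memLp_deriv : MemLp η' 2 (volume.restrict (Ioo 0 T))
  memLp_deriv2 : MemLp η'' 2 (volume.restrict (Ioo 0 T))
  hasWeakDeriv : HasWeakDeriv (Ioo 0 T) η η'
  hasWeakDeriv2 : HasWeakDeriv (Ioo 0 T) (fun t => toDual V (toH V (η' t))) η''
  equation : ∀ᵐ t ∂(volume.restrict (Ioo 0 T)),
    η'' t + lam • opA V κ (η' t) + opA V κ (η t) = f t (η t)
  initial : Tendsto η (𝓝[>] 0 ⊓ ae volume) (𝓝 u₀)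
  initial_deriv : Tendsto (fun t => toH V (η' t)) (𝓝[>] 0 ⊓ ae volume) (𝓝 v₀)

/-- `u ∈ V` has a representative that is continuous on `[-L, L]` and takes the value `y`
at `x`. -/
def HasValueAt (u : V) (x y : ℝ) : Prop :=
  ∃ c : ℝ → ℝ, ContinuousOn c (closure (interval L)) ∧
    toH V u =ᵐ[volume.restrict (interval L)] c ∧ c x = y

end Triple

end

end SineGordon

/-!
The equation is treated on an abstract Gelfand triple, given by a bounded map `ι : V → H` of Hilbert
spaces with dense range and a bounded form `a` with `‖u‖² ≤ |ι u|² + a(u, u)`; `V*` is read in `V`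
by Riesz representation. With `J` for integration in time from `0` and `w = η'`, so that
`η = u₀ + J w`, the problem becomes a parabolic equation for `w` with a nonlocal right-hand side,
`w' + lam A w = f(·, u₀ + J w) - A (u₀ + J w)`, `w(0) = v₀`, in `L²(0, T; V)`.

This space carries the weight `exp (-2γt)`. For the weighted norm, `J` is accretive with a gain,
`γ ‖J z‖² ≤ ⟪J z, z⟫` (`mul_norm_primitiveLp_sq_le`), and so `‖J‖ ≤ 1/γ`.

* Linear equation (`exists_linear_solution`). For the regular trajectories `w = v + J z`, with `v`
  and `z` valued in `V`, the energy identity bounds `w` in `L²(0, T; V)` and in `C([0, T]; H)` by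
  the data `(w(0), w' + lam A w)` in `H × L²(0, T; V*)`. Their data are dense, because accretivity
  of `J` passes to its adjoint. Hence the solution operator extends to all data, and neither a
  Galerkin approximation nor the theorem on continuity in `H` of functions in `L²(0, T; V)` with
  derivative in `L²(0, T; V*)` is needed.
* Semilinear equation (`exists_semilinear_solution`). A forcing that is Lipschitz in `L²(0, T)` is
  Lipschitz for almost every time (`IsLipschitzNemytskii.ae_norm_sub_le`), so the same constant
  serves for the weighted norm. As `w` enters the right-hand side only through `J w`, the fixed
  point map is a contraction for large `γ`. Its bounds give the energy estimate.
* Uniqueness (`primitiveLp_eq_zero_of_eq`). The difference of two solutions, integrated once in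
  time, is tested with the difference of the positions.
* The weak formulation agrees with the integrated equation by the lemma of du Bois-Reymond
  (`HasWeakDeriv.exists_ae_eq_add`).

On the interval, point evaluation is bounded on `V` up to the boundary by an explicit formula
(`exists_evaluation`), and the sine is Lipschitz.
-/

namespace SineGordon

noncomputable section

/-! ### Absolutely continuous functions with values in a Banach space -/

section AbsolutelyContinuous

variable {X Y : Type*} [NormedAddCommGroup X] [NormedAddCommGroup Y]

theorem absolutelyContinuous_of_dist_le {f : ℝ → X} {g : ℝ → Y} {a b : ℝ}
    (hg : AbsolutelyContinuousOnInterval g a b)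
    (h : ∀ s ∈ uIcc a b, ∀ t ∈ uIcc a b, dist (f s) (f t) ≤ dist (g s) (g t)) :
    AbsolutelyContinuousOnInterval f a b := by
  rw [absolutelyContinuousOnInterval_iff] at hg ⊢
  intro ε hε
  obtain ⟨δ, hδ, H⟩ := hg ε hε
  refine ⟨δ, hδ, fun E hE hlt => lt_of_le_of_lt (Finset.sum_le_sum fun i hi => ?_) (H E hE hlt)⟩
  exact h _ (hE.1 i hi).1 _ (hE.1 i hi).2

variable [NormedSpace ℝ X]

theorem absolutelyContinuous_primitive {w : ℝ → X} {a b c : ℝ}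
    (hw : IntervalIntegrable w volume a b) (hc : c ∈ uIcc a b) (x₀ : X) :
    AbsolutelyContinuousOnInterval (fun x => x₀ + ∫ s in c..x, w s) a b := by
  refine absolutelyContinuous_of_dist_le
    (hw.norm.absolutelyContinuousOnInterval_intervalIntegral hc) fun s hs t ht => ?_
  have hcs : IntervalIntegrable w volume c s := hw.mono_set (uIcc_subset_uIcc hc hs)
  have hct : IntervalIntegrable w volume c t := hw.mono_set (uIcc_subset_uIcc hc ht)
  rw [dist_add_left, dist_eq_norm, dist_eq_norm,
    intervalIntegral.integral_interval_sub_left hcs hct,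
    intervalIntegral.integral_interval_sub_left hcs.norm hct.norm]
  exact intervalIntegral.norm_integral_le_abs_integral_norm

theorem absolutelyContinuous_of_contDiff {φ : ℝ → X} (hφ : ContDiff ℝ 1 φ) (a b : ℝ) :
    AbsolutelyContinuousOnInterval φ a b :=
  hφ.contDiffOn.absolutelyContinuousOnInterval

variable [CompleteSpace X]

/-- The fundamental theorem of calculus for absolutely continuous functions with values in a
Banach space. Without the Radon-Nikodym property, almost everywhere differentiability is an
assumption. -/
theorem integral_eq_sub_of_absolutelyContinuous {f f' : ℝ → X} {a b : ℝ}
    (hf : AbsolutelyContinuousOnInterval f a b) (hint : IntervalIntegrable f' volume a b)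
    (hd : ∀ᵐ x, x ∈ uIcc a b → HasDerivAt f (f' x) x) :
    ∫ x in a..b, f' x = f b - f a := by
  have hg : AbsolutelyContinuousOnInterval (fun x => f x - (0 + ∫ s in a..x, f' s)) a b :=
    hf.fun_sub (absolutelyContinuous_primitive hint left_mem_uIcc 0)
  have hz : ∀ᵐ x, x ∈ uIcc a b → HasDerivAt (fun x => f x - (0 + ∫ s in a..x, f' s)) 0 x := by
    filter_upwards [hd, hint.ae_hasDerivAt_integral] with x h1 h2 hx
    simpa using (h1 hx).fun_sub ((h2 hx a left_mem_uIcc).const_add 0)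
  obtain ⟨C, hC⟩ := hg.const_of_ae_hasDerivAt_zero hz
  have ha := hC a left_mem_uIcc
  have hb := hC b right_mem_uIcc
  simp only [intervalIntegral.integral_same, zero_add, sub_zero] at ha hb
  rw [ha, ← hb]
  abel

/-- Integration by parts for a scalar function of class `C¹` and a primitive. -/
theorem integral_deriv_smul_primitive {φ : ℝ → ℝ} (hφ : ContDiff ℝ 1 φ) {w : ℝ → X} {a b c : ℝ}
    (hw : IntervalIntegrable w volume a b) (hc : c ∈ uIcc a b) (x₀ : X) :
    ∫ x in a..b, (deriv φ x • (x₀ + ∫ s in c..x, w s) + φ x • w x) =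
      φ b • (x₀ + ∫ s in c..b, w s) - φ a • (x₀ + ∫ s in c..a, w s) := by
  have hP := absolutelyContinuous_primitive hw hc x₀
  refine integral_eq_sub_of_absolutelyContinuous
    ((absolutelyContinuous_of_contDiff hφ a b).fun_smul hP) ?_ ?_
  · exact ((hφ.continuous_deriv le_rfl).continuousOn.smul hP.continuousOn).intervalIntegrable.add
      (hw.continuousOn_smul hφ.continuous.continuousOn)
  · filter_upwards [hw.ae_hasDerivAt_integral] with x h2 hx
    rw [add_comm]
    exact ((hφ.differentiable (by simp) x).hasDerivAt).smul ((h2 hx c hc).const_add x₀)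

end AbsolutelyContinuous

/-- The weighted energy identity for a primitive with values in a Hilbert space. -/
theorem integral_weighted_energy {X : Type*} [NormedAddCommGroup X] [InnerProductSpace ℝ X]
    [CompleteSpace X] {ρ : ℝ → ℝ} (hρ : ContDiff ℝ 1 ρ) {z : ℝ → X} {a b : ℝ}
    (hz : IntervalIntegrable z volume a b) (x₀ : X) :
    ∫ t in a..b, (deriv ρ t * ‖x₀ + ∫ s in a..t, z s‖ ^ 2 +
        ρ t * (2 * inner ℝ (x₀ + ∫ s in a..t, z s) (z t))) =
      ρ b * ‖x₀ + ∫ s in a..b, z s‖ ^ 2 - ρ a * ‖x₀‖ ^ 2 := by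
  have hP := absolutelyContinuous_primitive hz left_mem_uIcc x₀
  have hN : AbsolutelyContinuousOnInterval (fun t => ‖x₀ + ∫ s in a..t, z s‖) a b :=
    absolutelyContinuous_of_dist_le hP fun s _ t _ => by
      rw [Real.dist_eq, dist_eq_norm]; exact abs_norm_sub_norm_le _ _
  have hN2 : AbsolutelyContinuousOnInterval (fun t => ‖x₀ + ∫ s in a..t, z s‖ ^ 2) a b := by
    simpa only [pow_two] using! hN.mul hN
  have hI : IntervalIntegrable (fun t => inner ℝ (x₀ + ∫ s in a..t, z s) (z t)) volume a b := by
    obtain ⟨C, hC⟩ := hP.exists_bound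
    have h1 : AEStronglyMeasurable (fun t => x₀ + ∫ s in a..t, z s)
        (volume.restrict (uIoc a b)) :=
      (hP.continuousOn.mono uIoc_subset_uIcc).aestronglyMeasurable measurableSet_uIoc
    rw [intervalIntegrable_iff] at hz ⊢
    refine Integrable.mono' (hz.norm.const_mul C) (h1.inner hz.aestronglyMeasurable) ?_
    filter_upwards [ae_restrict_mem measurableSet_uIoc] with t ht
    exact (norm_inner_le_norm _ _).trans
      (mul_le_mul_of_nonneg_right (hC t (uIoc_subset_uIcc ht)) (norm_nonneg _))
  have h := integral_eq_sub_of_absolutelyContinuous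
    ((absolutelyContinuous_of_contDiff hρ a b).fun_mul hN2)
    (f' := fun t => deriv ρ t * ‖x₀ + ∫ s in a..t, z s‖ ^ 2 +
        ρ t * (2 * inner ℝ (x₀ + ∫ s in a..t, z s) (z t))) ?_ ?_
  · rw [h]; simp
  · exact ((hρ.continuous_deriv le_rfl).continuousOn.mul hN2.continuousOn).intervalIntegrable.add
      ((hI.const_mul 2).continuousOn_mul hρ.continuous.continuousOn)
  · filter_upwards [hz.ae_hasDerivAt_integral] with x h2 hx
    exact ((hρ.differentiable (by simp) x).hasDerivAt).mul
      ((h2 hx a left_mem_uIcc).const_add x₀).norm_sq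

/-! ### The exponentially weighted time interval -/

/-- The measure `exp (-2γt) dt` on `(0, T)`. The spaces `L²(0, T; X)` for this measure and for
Lebesgue measure coincide; for large `γ` integration in time is a small operator. -/
def expMeasure (γ T : ℝ) : Measure ℝ :=
  (volume.restrict (Ioo 0 T)).withDensity fun t => ENNReal.ofReal (Real.exp (-(2 * γ) * t))

theorem expMeasure_le_smul (γ T : ℝ) :
    expMeasure γ T ≤
      ENNReal.ofReal (Real.exp (2 * (|γ| * |T|))) • volume.restrict (Ioo 0 T) := by
  rw [← withDensity_const]
  refine withDensity_mono ?_
  filter_upwards [ae_restrict_mem measurableSet_Ioo] with t ht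
  refine ENNReal.ofReal_le_ofReal (Real.exp_le_exp.2 ?_)
  have h1 : |γ| * t ≤ |γ| * |T| :=
    mul_le_mul_of_nonneg_left (ht.2.le.trans (le_abs_self T)) (abs_nonneg γ)
  nlinarith [neg_abs_le γ, ht.1]

theorem restrict_le_smul_expMeasure (γ T : ℝ) :
    volume.restrict (Ioo 0 T) ≤
      ENNReal.ofReal (Real.exp (2 * (|γ| * |T|))) • expMeasure γ T := by
  rw [expMeasure, ← withDensity_smul _ (by fun_prop)]
  conv_lhs => rw [← withDensity_one (μ := volume.restrict (Ioo 0 T))]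
  refine withDensity_mono ?_
  filter_upwards [ae_restrict_mem measurableSet_Ioo] with t ht
  rw [Pi.smul_apply, smul_eq_mul, ← ENNReal.ofReal_mul (Real.exp_pos _).le, ← Real.exp_add,
    Pi.one_apply, ← ENNReal.ofReal_one]
  refine ENNReal.ofReal_le_ofReal (Real.one_le_exp ?_)
  have h1 : |γ| * t ≤ |γ| * |T| :=
    mul_le_mul_of_nonneg_left (ht.2.le.trans (le_abs_self T)) (abs_nonneg γ)
  nlinarith [le_abs_self γ, ht.1]

theorem expMeasure_le {γ : ℝ} (hγ : 0 ≤ γ) (T : ℝ) :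
    expMeasure γ T ≤ volume.restrict (Ioo 0 T) := by
  conv_rhs => rw [← withDensity_one (μ := volume.restrict (Ioo 0 T))]
  refine withDensity_mono ?_
  filter_upwards [ae_restrict_mem measurableSet_Ioo] with t ht
  rw [Pi.one_apply, ← ENNReal.ofReal_one]
  refine ENNReal.ofReal_le_ofReal (Real.exp_le_one_iff.2 ?_)
  nlinarith [ht.1]

instance (γ T : ℝ) : IsFiniteMeasure (expMeasure γ T) :=
  ⟨lt_of_le_of_lt (expMeasure_le_smul γ T univ) (by simp [ENNReal.mul_lt_top])⟩

theorem ae_expMeasure (γ T : ℝ) : ae (expMeasure γ T) = ae (volume.restrict (Ioo 0 T)) := by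
  refine le_antisymm ?_ ?_
  · exact (Measure.AbsolutelyContinuous.trans
      (Measure.absolutelyContinuous_of_le (expMeasure_le_smul γ T))
      (Measure.smul_absolutelyContinuous)).ae_le
  · exact (Measure.AbsolutelyContinuous.trans
      (Measure.absolutelyContinuous_of_le (restrict_le_smul_expMeasure γ T))
      (Measure.smul_absolutelyContinuous)).ae_le

theorem memLp_expMeasure {X : Type*} [NormedAddCommGroup X] {γ T : ℝ} {f : ℝ → X} :
    MemLp f 2 (expMeasure γ T) ↔ MemLp f 2 (volume.restrict (Ioo 0 T)) :=
  ⟨fun h => (h.smul_measure ENNReal.ofReal_ne_top).mono_measure (restrict_le_smul_expMeasure γ T),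
    fun h => (h.smul_measure ENNReal.ofReal_ne_top).mono_measure (expMeasure_le_smul γ T)⟩

theorem integral_expMeasure {X : Type*} [NormedAddCommGroup X] [NormedSpace ℝ X] (γ T : ℝ)
    (f : ℝ → X) :
    ∫ t, f t ∂(expMeasure γ T) = ∫ t in Ioo 0 T, Real.exp (-(2 * γ) * t) • f t := by
  rw [expMeasure, integral_withDensity_eq_integral_toReal_smul (by fun_prop) (by simp)]
  simp [ENNReal.toReal_ofReal (Real.exp_pos _).le]

section Hilbert

variable {X : Type*} [NormedAddCommGroup X] [InnerProductSpace ℝ X]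

theorem norm_sq_eq_integral {μ : Measure ℝ} (w : Lp X 2 μ) : ‖w‖ ^ 2 = ∫ t, ‖w t‖ ^ 2 ∂μ := by
  rw [← real_inner_self_eq_norm_sq, L2.inner_def]
  simp

omit [InnerProductSpace ℝ X] in
theorem Lp_memLp_restrict {γ T : ℝ} (w : Lp X 2 (expMeasure γ T)) :
    MemLp w 2 (volume.restrict (Ioo 0 T)) :=
  memLp_expMeasure.1 (Lp.memLp w)

omit [InnerProductSpace ℝ X] in
theorem Lp_integrableOn {γ T : ℝ} (w : Lp X 2 (expMeasure γ T)) :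
    IntegrableOn w (Ioo 0 T) :=
  (Lp_memLp_restrict w).integrable (by norm_num)

omit [InnerProductSpace ℝ X] in
theorem Lp_intervalIntegrable {γ T : ℝ} (w : Lp X 2 (expMeasure γ T)) {t : ℝ}
    (ht : t ∈ Icc 0 T) : IntervalIntegrable w volume 0 t := by
  rw [intervalIntegrable_iff_integrableOn_Ioo_of_le ht.1]
  exact (Lp_integrableOn w).mono_set (Ioo_subset_Ioo_right ht.2)

theorem setIntegral_norm_sq_le {γ T : ℝ} (w : Lp X 2 (expMeasure γ T)) :
    ∫ t in Ioo 0 T, ‖w t‖ ^ 2 ≤ Real.exp (2 * (|γ| * |T|)) * ‖w‖ ^ 2 := by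
  rw [norm_sq_eq_integral]
  refine (integral_mono_measure (restrict_le_smul_expMeasure γ T)
    (ae_of_all _ fun t => by positivity)
    (((Lp.memLp w).integrable_norm_pow (by norm_num)).smul_measure ENNReal.ofReal_ne_top)).trans ?_
  rw [integral_smul_measure, ENNReal.toReal_ofReal (Real.exp_pos _).le, smul_eq_mul]

theorem setIntegral_norm_le {γ T : ℝ} (w : Lp X 2 (expMeasure γ T)) :
    ∫ t in Ioo 0 T, ‖w t‖ ≤ Real.exp (|γ| * |T|) * √|T| * ‖w‖ := by
  have h2 : MemLp (fun t => ‖w t‖) (ENNReal.ofReal 2) (volume.restrict (Ioo 0 T)) := by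
    simpa using (Lp_memLp_restrict w).norm
  have h1 : MemLp (fun _ => (1 : ℝ)) (ENNReal.ofReal 2) (volume.restrict (Ioo 0 T)) :=
    memLp_const 1
  have h := integral_mul_le_Lp_mul_Lq_of_nonneg (μ := volume.restrict (Ioo 0 T))
    Real.HolderConjugate.two_two (ae_of_all _ fun t => norm_nonneg (w t))
    (ae_of_all _ fun _ => zero_le_one) h2 h1
  simp only [mul_one, one_pow, integral_const, smul_eq_mul, ← Real.sqrt_eq_rpow,
    Real.rpow_ofNat, measureReal_restrict_apply_univ, Real.volume_real_Ioo, sub_zero] at h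
  refine h.trans ?_
  have h3 : √(∫ t in Ioo 0 T, ‖w t‖ ^ 2) ≤ Real.exp (|γ| * |T|) * ‖w‖ := by
    refine Real.sqrt_le_iff.2 ⟨by positivity, (setIntegral_norm_sq_le w).trans (le_of_eq ?_)⟩
    rw [mul_pow, ← Real.exp_nat_mul]
    norm_num
  have h4 : √(max T 0) ≤ √|T| := Real.sqrt_le_sqrt (max_le (le_abs_self T) (abs_nonneg T))
  calc _ ≤ (Real.exp (|γ| * |T|) * ‖w‖) * √|T| := by gcongr
    _ = _ := by ring

/-! ### Integration in time -/

theorem norm_integral_indicator_le {γ T : ℝ} (w : Lp X 2 (expMeasure γ T)) (t : ℝ) :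
    ‖∫ s in (0 : ℝ)..t, (Ioo 0 T).indicator w s‖ ≤ Real.exp (|γ| * |T|) * √|T| * ‖w‖ := by
  refine le_trans ?_ (setIntegral_norm_le w)
  refine intervalIntegral.norm_integral_le_integral_norm_uIoc.trans ?_
  rw [← integral_indicator measurableSet_Ioo]
  simp only [norm_indicator_eq_indicator_norm]
  exact setIntegral_le_integral
    (IntegrableOn.integrable_indicator (Lp_integrableOn w).norm measurableSet_Ioo)
    (ae_of_all _ fun s => indicator_nonneg (fun _ _ => norm_nonneg _) s)

/-- Integration from `0`, as an operator from `L²(0, T; X)` to bounded continuous functions on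
the line; the integrand is extended by zero outside `(0, T)`. -/
def primitiveBCF (X : Type*) [NormedAddCommGroup X] [InnerProductSpace ℝ X] (γ T : ℝ) :
    Lp X 2 (expMeasure γ T) →L[ℝ] BoundedContinuousFunction ℝ X :=
  LinearMap.mkContinuous
    { toFun := fun w => BoundedContinuousFunction.ofNormedAddCommGroup
        (fun t => ∫ s in (0 : ℝ)..t, (Ioo 0 T).indicator w s)
        (intervalIntegral.continuous_primitive (fun a b =>
          ((Lp_integrableOn w).integrable_indicator measurableSet_Ioo).intervalIntegrable) 0)
        (Real.exp (|γ| * |T|) * √|T| * ‖w‖) (norm_integral_indicator_le w)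
      map_add' := fun u v => by
        ext t
        change ∫ s in (0 : ℝ)..t, (Ioo 0 T).indicator (⇑(u + v)) s =
          (∫ s in (0 : ℝ)..t, (Ioo 0 T).indicator u s) +
            ∫ s in (0 : ℝ)..t, (Ioo 0 T).indicator v s
        rw [← intervalIntegral.integral_add
          ((Lp_integrableOn u).integrable_indicator measurableSet_Ioo).intervalIntegrable
          ((Lp_integrableOn v).integrable_indicator measurableSet_Ioo).intervalIntegrable]
        refine intervalIntegral.integral_congr_ae ?_
        have h := Lp.coeFn_add u v
        rw [EventuallyEq, ae_expMeasure, ae_restrict_iff' measurableSet_Ioo] at h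
        filter_upwards [h] with s hs _
        by_cases hm : s ∈ Ioo 0 T
        · simp only [indicator_of_mem hm, hs hm, Pi.add_apply]
        · simp only [indicator_of_notMem hm, add_zero]
      map_smul' := fun c u => by
        ext t
        change ∫ s in (0 : ℝ)..t, (Ioo 0 T).indicator (⇑(c • u)) s =
          c • ∫ s in (0 : ℝ)..t, (Ioo 0 T).indicator u s
        rw [← intervalIntegral.integral_smul]
        refine intervalIntegral.integral_congr_ae ?_
        have h := Lp.coeFn_smul c u
        rw [EventuallyEq, ae_expMeasure, ae_restrict_iff' measurableSet_Ioo] at h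
        filter_upwards [h] with s hs _
        by_cases hm : s ∈ Ioo 0 T
        · simp only [indicator_of_mem hm, hs hm, Pi.smul_apply]
        · simp only [indicator_of_notMem hm, smul_zero] }
    (Real.exp (|γ| * |T|) * √|T|)
    (fun w => BoundedContinuousFunction.norm_ofNormedAddCommGroup_le _ (by positivity)
      (norm_integral_indicator_le w))

variable {γ T : ℝ}

theorem norm_primitiveBCF_apply_le (w : Lp X 2 (expMeasure γ T)) (t : ℝ) :
    ‖primitiveBCF X γ T w t‖ ≤ Real.exp (|γ| * |T|) * √|T| * ‖w‖ :=
  norm_integral_indicator_le w t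

theorem primitiveBCF_apply (w : Lp X 2 (expMeasure γ T)) {t : ℝ} (ht : t ∈ Icc 0 T) :
    primitiveBCF X γ T w t = ∫ s in (0 : ℝ)..t, w s := by
  change ∫ s in (0 : ℝ)..t, (Ioo 0 T).indicator w s = _
  rw [intervalIntegral.integral_of_le ht.1, intervalIntegral.integral_of_le ht.1,
    integral_Ioc_eq_integral_Ioo, integral_Ioc_eq_integral_Ioo]
  refine setIntegral_congr_fun measurableSet_Ioo fun s hs => ?_
  exact indicator_of_mem (Ioo_subset_Ioo_right ht.2 hs) _

theorem primitiveBCF_zero (w : Lp X 2 (expMeasure γ T)) : primitiveBCF X γ T w 0 = 0 :=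
  intervalIntegral.integral_same

theorem exists_primitiveBCF_eq (w : Lp X 2 (expMeasure γ T)) (hT : 0 ≤ T) (t : ℝ) :
    ∃ s ∈ Icc 0 T, primitiveBCF X γ T w t = primitiveBCF X γ T w s := by
  rcases le_total t 0 with h0 | h0
  · refine ⟨0, left_mem_Icc.2 hT, ?_⟩
    rw [primitiveBCF_zero]
    refine (intervalIntegral.integral_congr (g := fun _ => 0) fun s hs => ?_).trans
      intervalIntegral.integral_zero
    rw [uIcc_of_ge h0] at hs
    exact indicator_of_notMem (fun h => h.1.not_ge hs.2) _
  rcases le_total T t with h1 | h1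
  · refine ⟨T, right_mem_Icc.2 hT, ?_⟩
    have hi : Integrable ((Ioo 0 T).indicator w) :=
      (Lp_integrableOn w).integrable_indicator measurableSet_Ioo
    have h2 : ∫ s in T..t, (Ioo 0 T).indicator w s = 0 := by
      refine (intervalIntegral.integral_congr (g := fun _ => 0) fun s hs => ?_).trans
        intervalIntegral.integral_zero
      rw [uIcc_of_le h1] at hs
      exact indicator_of_notMem (fun h => h.2.not_ge hs.1) _
    change ∫ s in (0 : ℝ)..t, (Ioo 0 T).indicator w s = ∫ s in (0 : ℝ)..T, (Ioo 0 T).indicator w s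
    rw [← intervalIntegral.integral_add_adjacent_intervals hi.intervalIntegrable
      hi.intervalIntegrable, h2, add_zero]
  · exact ⟨t, ⟨h0, h1⟩, rfl⟩

/-- Integration from `0`, as an operator on `L²(0, T; X)`. -/
def primitiveLp (X : Type*) [NormedAddCommGroup X] [InnerProductSpace ℝ X] (γ T : ℝ) :
    Lp X 2 (expMeasure γ T) →L[ℝ] Lp X 2 (expMeasure γ T) :=
  (BoundedContinuousFunction.toLp 2 (expMeasure γ T) ℝ).comp (primitiveBCF X γ T)

theorem coeFn_primitiveLp (w : Lp X 2 (expMeasure γ T)) :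
    primitiveLp X γ T w =ᵐ[expMeasure γ T] primitiveBCF X γ T w :=
  BoundedContinuousFunction.coeFn_toLp _ _ _ _

/-- The constant functions in `L²(0, T; X)`. -/
def constLp (X : Type*) [NormedAddCommGroup X] [InnerProductSpace ℝ X] (γ T : ℝ) :
    X →L[ℝ] Lp X 2 (expMeasure γ T) :=
  Lp.constL 2 (expMeasure γ T) ℝ

theorem coeFn_constLp (x : X) : constLp X γ T x =ᵐ[expMeasure γ T] fun _ => x :=
  Lp.coeFn_const 2 _ x

theorem norm_constLp_le (hγ : 0 ≤ γ) (x : X) : ‖constLp X γ T x‖ ≤ √|T| * ‖x‖ := by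
  refine le_of_sq_le_sq ?_ (by positivity)
  rw [norm_sq_eq_integral, mul_pow, Real.sq_sqrt (abs_nonneg T)]
  have h : ∫ t, ‖constLp X γ T x t‖ ^ 2 ∂(expMeasure γ T) =
      (expMeasure γ T).real univ * ‖x‖ ^ 2 := by
    rw [integral_congr_ae ((coeFn_constLp x).mono fun t ht => by rw [ht])]
    simp
  rw [h]
  gcongr
  refine ENNReal.toReal_le_of_le_ofReal (abs_nonneg T) ((expMeasure_le hγ T univ).trans ?_)
  simpa using ENNReal.ofReal_le_ofReal (le_abs_self T)

/-- A bounded operator acts on `L²(0, T; X)` pointwise in time. -/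
def liftLp {Y : Type*} [NormedAddCommGroup Y] [InnerProductSpace ℝ Y] (γ T : ℝ)
    (Q : X →L[ℝ] Y) : Lp X 2 (expMeasure γ T) →L[ℝ] Lp Y 2 (expMeasure γ T) :=
  Q.compLpL 2 (expMeasure γ T)

theorem coeFn_liftLp {Y : Type*} [NormedAddCommGroup Y] [InnerProductSpace ℝ Y]
    (Q : X →L[ℝ] Y) (w : Lp X 2 (expMeasure γ T)) :
    liftLp γ T Q w =ᵐ[expMeasure γ T] fun t => Q (w t) :=
  Q.coeFn_compLpL w

section Lift

variable {Y : Type*} [NormedAddCommGroup Y] [InnerProductSpace ℝ Y]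
  [CompleteSpace X] [CompleteSpace Y]

theorem primitiveBCF_liftLp (Q : X →L[ℝ] Y) (w : Lp X 2 (expMeasure γ T)) (t : ℝ) :
    primitiveBCF Y γ T (liftLp γ T Q w) t = Q (primitiveBCF X γ T w t) := by
  change ∫ s in (0 : ℝ)..t, (Ioo 0 T).indicator (⇑(liftLp γ T Q w)) s =
    Q (∫ s in (0 : ℝ)..t, (Ioo 0 T).indicator w s)
  rw [← Q.intervalIntegral_comp_comm
    ((Lp_integrableOn w).integrable_indicator measurableSet_Ioo).intervalIntegrable]
  refine intervalIntegral.integral_congr_ae ?_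
  have h := coeFn_liftLp Q w
  rw [EventuallyEq, ae_expMeasure, ae_restrict_iff' measurableSet_Ioo] at h
  filter_upwards [h] with s hs _
  by_cases hm : s ∈ Ioo 0 T
  · simp only [indicator_of_mem hm, hs hm]
  · simp only [indicator_of_notMem hm, map_zero]

theorem primitiveLp_liftLp (Q : X →L[ℝ] Y) (w : Lp X 2 (expMeasure γ T)) :
    primitiveLp Y γ T (liftLp γ T Q w) = liftLp γ T Q (primitiveLp X γ T w) := by
  ext1
  filter_upwards [coeFn_primitiveLp (liftLp γ T Q w), coeFn_liftLp Q (primitiveLp X γ T w),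
    coeFn_primitiveLp w] with t h1 h2 h3
  rw [h1, h2, h3, primitiveBCF_liftLp]

omit [CompleteSpace X] [CompleteSpace Y] in
theorem liftLp_constLp (Q : X →L[ℝ] Y) (x : X) :
    liftLp γ T Q (constLp X γ T x) = constLp Y γ T (Q x) := by
  ext1
  filter_upwards [coeFn_liftLp Q (constLp X γ T x), coeFn_constLp (γ := γ) (T := T) x,
    coeFn_constLp (γ := γ) (T := T) (Q x)] with t h1 h2 h3
  rw [h1, h2, h3]

theorem adjoint_liftLp (Q : X →L[ℝ] Y) :
    ContinuousLinearMap.adjoint (liftLp γ T Q) = liftLp γ T (ContinuousLinearMap.adjoint Q) := by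
  refine ((ContinuousLinearMap.eq_adjoint_iff _ _).2 fun y x => ?_).symm
  rw [L2.inner_def, L2.inner_def]
  refine integral_congr_ae ?_
  filter_upwards [coeFn_liftLp Q x, coeFn_liftLp (ContinuousLinearMap.adjoint Q) y] with t h1 h2
  rw [h1, h2, ContinuousLinearMap.adjoint_inner_left]

end Lift

theorem weighted_energy [CompleteSpace X] (z : Lp X 2 (expMeasure γ T)) (x₀ : X) {t : ℝ}
    (ht : t ∈ Icc 0 T) :
    ∫ s in (0 : ℝ)..t, Real.exp (-(2 * γ) * s) *
        (2 * inner ℝ (x₀ + primitiveBCF X γ T z s) (z s) -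
          2 * γ * ‖x₀ + primitiveBCF X γ T z s‖ ^ 2) =
      Real.exp (-(2 * γ) * t) * ‖x₀ + primitiveBCF X γ T z t‖ ^ 2 - ‖x₀‖ ^ 2 := by
  have h := integral_weighted_energy (ρ := fun s => Real.exp (-(2 * γ) * s)) (by fun_prop)
    (Lp_intervalIntegrable z ht) x₀
  rw [primitiveBCF_apply z ht]
  simp only [mul_zero, Real.exp_zero, one_mul] at h
  rw [← h]
  refine intervalIntegral.integral_congr fun s hs => ?_
  rw [uIcc_of_le ht.1] at hs
  have hd : deriv (fun s => Real.exp (-(2 * γ) * s)) s =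
      Real.exp (-(2 * γ) * s) * (-(2 * γ)) := by
    simpa using (((hasDerivAt_id s).const_mul (-(2 * γ))).exp).deriv
  simp only [hd, primitiveBCF_apply z ⟨hs.1, hs.2.trans ht.2⟩]
  ring

/-- Integration in time is accretive, with a gain `γ` that comes from the weight. -/
theorem mul_norm_primitiveLp_sq_le [CompleteSpace X] (hT : 0 ≤ T)
    (z : Lp X 2 (expMeasure γ T)) :
    γ * ‖primitiveLp X γ T z‖ ^ 2 ≤ inner ℝ (primitiveLp X γ T z) z := by
  have h := weighted_energy z 0 (right_mem_Icc.2 hT)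
  simp only [zero_add, norm_zero] at h
  have h1 : ∫ s in (0 : ℝ)..T, Real.exp (-(2 * γ) * s) *
        (2 * inner ℝ (primitiveBCF X γ T z s) (z s) -
          2 * γ * ‖primitiveBCF X γ T z s‖ ^ 2) =
      2 * inner ℝ (primitiveLp X γ T z) z - 2 * γ * ‖primitiveLp X γ T z‖ ^ 2 := by
    rw [intervalIntegral.integral_of_le hT, integral_Ioc_eq_integral_Ioo, norm_sq_eq_integral,
      L2.inner_def, ← integral_const_mul, ← integral_const_mul, ← integral_sub]
    · rw [integral_expMeasure]
      refine integral_congr_ae ?_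
      have hc := coeFn_primitiveLp z
      rw [EventuallyEq, ae_expMeasure] at hc
      filter_upwards [hc] with s hs
      rw [hs, smul_eq_mul]
    · exact (L2.integrable_inner (𝕜 := ℝ) (primitiveLp X γ T z) z).const_mul 2
    · exact ((Lp.memLp (primitiveLp X γ T z)).integrable_norm_pow (by norm_num)).const_mul _
  rw [h1] at h
  have h2 : 0 ≤ Real.exp (-(2 * γ) * T) * ‖primitiveBCF X γ T z T‖ ^ 2 := by positivity
  linarith

theorem norm_primitiveLp_le [CompleteSpace X] (hT : 0 ≤ T) (hγ : 0 < γ)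
    (z : Lp X 2 (expMeasure γ T)) : ‖primitiveLp X γ T z‖ ≤ γ⁻¹ * ‖z‖ := by
  have h := (mul_norm_primitiveLp_sq_le hT z).trans (real_inner_le_norm _ _)
  rw [inv_mul_eq_div, le_div_iff₀ hγ]
  rcases (norm_nonneg (primitiveLp X γ T z)).eq_or_lt with h0 | h0
  · rw [← h0, zero_mul]; exact norm_nonneg z
  · refine le_of_mul_le_mul_left ?_ h0
    linarith

/-- Accretivity of a bounded operator `S` with a bounded gain, `γ ‖S x‖² ≤ ⟪S x, x⟫`, says that
`1 - 2γS` is a contraction, so that it passes to the adjoint. -/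
theorem mul_norm_adjoint_sq_le {E : Type*} [NormedAddCommGroup E] [InnerProductSpace ℝ E]
    [CompleteSpace E] {S : E →L[ℝ] E} {γ : ℝ} (hγ : 0 < γ)
    (h : ∀ x, γ * ‖S x‖ ^ 2 ≤ inner ℝ (S x) x) (x : E) :
    γ * ‖ContinuousLinearMap.adjoint S x‖ ^ 2 ≤
      inner ℝ (ContinuousLinearMap.adjoint S x) x := by
  have key : ∀ (R : E →L[ℝ] E) (x : E), ‖(1 - (2 * γ) • R) x‖ ^ 2 =
      ‖x‖ ^ 2 - 4 * γ * (inner ℝ (R x) x - γ * ‖R x‖ ^ 2) := by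
    intro R x
    change ‖x - (2 * γ) • R x‖ ^ 2 = _
    rw [norm_sub_sq_real, inner_smul_right, norm_smul, mul_pow, Real.norm_eq_abs, sq_abs,
      real_inner_comm]
    ring
  have h1 : ‖1 - (2 * γ) • S‖ ≤ 1 := by
    refine ContinuousLinearMap.opNorm_le_bound _ zero_le_one fun y => ?_
    rw [one_mul]
    refine le_of_sq_le_sq ?_ (norm_nonneg y)
    rw [key]
    nlinarith [h y]
  have h2 : ‖1 - (2 * γ) • ContinuousLinearMap.adjoint S‖ ≤ 1 := by
    have : ContinuousLinearMap.adjoint (1 - (2 * γ) • S) =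
        1 - (2 * γ) • ContinuousLinearMap.adjoint S := by
      simp [← ContinuousLinearMap.star_eq_adjoint]
    rw [← this, LinearIsometryEquiv.norm_map]
    exact h1
  have h3 := ContinuousLinearMap.le_of_opNorm_le _ h2 x
  have h4 := key (ContinuousLinearMap.adjoint S) x
  rw [one_mul] at h3
  have h5 := pow_le_pow_left₀ (norm_nonneg _) h3 2
  rw [h4] at h5
  nlinarith

theorem primitiveLp_injective [CompleteSpace X] {w : Lp X 2 (expMeasure γ T)}
    (hw : primitiveLp X γ T w = 0) : w = 0 := by
  have h0 : ∀ᵐ t, t ∈ Ioo 0 T → primitiveBCF X γ T w t = 0 := by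
    rw [← ae_restrict_iff' measurableSet_Ioo, ← ae_expMeasure γ T]
    filter_upwards [coeFn_primitiveLp w, Lp.coeFn_zero X 2 (expMeasure γ T)] with t h1 h2
    rw [← h1, hw, h2, Pi.zero_apply]
  have h1 : EqOn (primitiveBCF X γ T w) 0 (Ioo 0 T) :=
    Measure.eqOn_open_of_ae_eq (μ := volume) ((ae_restrict_iff' measurableSet_Ioo).2 h0) isOpen_Ioo
      (primitiveBCF X γ T w).continuous.continuousOn continuousOn_const
  ext1
  refine EventuallyEq.trans ?_ (Lp.coeFn_zero X 2 (expMeasure γ T)).symm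
  rw [EventuallyEq, ae_expMeasure, ae_restrict_iff' measurableSet_Ioo]
  rcases le_total T 0 with hT | hT
  · exact ae_of_all _ fun t ht => absurd (ht.1.trans ht.2) hT.not_gt
  filter_upwards [(Lp_intervalIntegrable w (right_mem_Icc.2 hT)).ae_hasDerivAt_integral]
    with t h2 ht
  have h3 := h2 (by rw [uIcc_of_le hT]; exact Ioo_subset_Icc_self ht) 0 left_mem_uIcc
  refine h3.unique ((hasDerivAt_const t (0 : X)).congr_of_eventuallyEq ?_)
  filter_upwards [Ioo_mem_nhds ht.1 ht.2] with s hs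
  rw [← primitiveBCF_apply w (Ioo_subset_Icc_self hs), h1 hs, Pi.zero_apply]

end Hilbert

/-! ### The linear parabolic equation `w' + lam A w = F`, `w(0) = v₀` -/

section Linear

variable {V H : Type*} [NormedAddCommGroup V] [InnerProductSpace ℝ V] [CompleteSpace V]
  [NormedAddCommGroup H] [InnerProductSpace ℝ H] [CompleteSpace H]
  (ι : V →L[ℝ] H) (A : V →L[ℝ] V) (lam γ T : ℝ)

/-- The embedding `V → V*`, read as an operator on `V` by Riesz representation. -/
abbrev gram : V →L[ℝ] V := (ContinuousLinearMap.adjoint ι).comp ι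

theorem inner_gram (u v : V) : inner ℝ (gram ι u) v = inner ℝ (ι u) (ι v) :=
  ContinuousLinearMap.adjoint_inner_left ι v (ι u)

/-- The regular trajectories `t ↦ v + ∫₀ᵗ z` with `v ∈ V`, `z ∈ L²(0, T; V)`. -/
def regularSol : V × Lp V 2 (expMeasure γ T) →L[ℝ] Lp V 2 (expMeasure γ T) :=
  (constLp V γ T).comp (ContinuousLinearMap.fst ℝ _ _) +
    (primitiveLp V γ T).comp (ContinuousLinearMap.snd ℝ _ _)

/-- The data `(w(0), w' + lam A w)` of a regular trajectory `w`. -/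
def regularData : V × Lp V 2 (expMeasure γ T) →L[ℝ] WithLp 2 (H × Lp V 2 (expMeasure γ T)) :=
  (WithLp.prodContinuousLinearEquiv 2 ℝ H (Lp V 2 (expMeasure γ T))).symm.toContinuousLinearMap.comp
    ((ι.comp (ContinuousLinearMap.fst ℝ _ _)).prod
      ((liftLp γ T (gram ι)).comp (ContinuousLinearMap.snd ℝ _ _) +
        lam • (liftLp γ T A).comp (regularSol γ T)))

/-- A regular trajectory as a continuous function with values in `H`. -/
def regularSolBCF : V × Lp V 2 (expMeasure γ T) →ₗ[ℝ] BoundedContinuousFunction ℝ H where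
  toFun x := BoundedContinuousFunction.const ℝ (ι x.1) + primitiveBCF H γ T (liftLp γ T ι x.2)
  map_add' x y := by
    ext t
    simp only [Prod.fst_add, Prod.snd_add, map_add, BoundedContinuousFunction.coe_add,
      Pi.add_apply, BoundedContinuousFunction.const_apply]
    abel
  map_smul' c x := by
    ext t
    simp only [Prod.smul_fst, Prod.smul_snd, map_smul, BoundedContinuousFunction.coe_add,
      Pi.add_apply, BoundedContinuousFunction.const_apply, BoundedContinuousFunction.coe_smul,
      RingHom.id_apply, smul_add]

variable {γ T}

theorem regularSolBCF_apply (x : V × Lp V 2 (expMeasure γ T)) (t : ℝ) :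
    regularSolBCF ι γ T x t = ι (x.1 + primitiveBCF V γ T x.2 t) := by
  rw [map_add, ← primitiveBCF_liftLp]
  rfl

omit [CompleteSpace V] in
theorem coeFn_regularSol (x : V × Lp V 2 (expMeasure γ T)) :
    regularSol γ T x =ᵐ[expMeasure γ T] fun t => x.1 + primitiveBCF V γ T x.2 t := by
  filter_upwards [Lp.coeFn_add (constLp V γ T x.1) (primitiveLp V γ T x.2),
    coeFn_constLp (γ := γ) (T := T) x.1, coeFn_primitiveLp x.2] with t h1 h2 h3
  rw [← h3]
  nth_rw 1 [← h2]
  exact h1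

theorem inner_liftLp_gram (w u : Lp V 2 (expMeasure γ T)) :
    inner ℝ (liftLp γ T (gram ι) w) u = inner ℝ (liftLp γ T ι w) (liftLp γ T ι u) := by
  rw [L2.inner_def, L2.inner_def]
  refine integral_congr_ae ?_
  filter_upwards [coeFn_liftLp (gram ι) w, coeFn_liftLp ι w, coeFn_liftLp ι u] with t h1 h2 h3
  rw [h1, h2, h3, inner_gram]

omit [CompleteSpace V] [CompleteSpace H] in
theorem coercive_liftLp {ι : V →L[ℝ] H} {A : V →L[ℝ] V} {lam : ℝ}
    (hA : ∀ u, lam * ‖u‖ ^ 2 ≤ γ * ‖ι u‖ ^ 2 + lam * inner ℝ (A u) u)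
    (w : Lp V 2 (expMeasure γ T)) :
    lam * ‖w‖ ^ 2 ≤ γ * ‖liftLp γ T ι w‖ ^ 2 + lam * inner ℝ (liftLp γ T A w) w := by
  rw [norm_sq_eq_integral, norm_sq_eq_integral, L2.inner_def, ← integral_const_mul,
    ← integral_const_mul, ← integral_const_mul, ← integral_add]
  · refine integral_mono_ae (((Lp.memLp w).integrable_norm_pow (by norm_num)).const_mul _)
      ((((Lp.memLp (liftLp γ T ι w)).integrable_norm_pow (by norm_num)).const_mul _).add
        ((L2.integrable_inner (𝕜 := ℝ) (liftLp γ T A w) w).const_mul _)) ?_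
    filter_upwards [coeFn_liftLp ι w, coeFn_liftLp A w] with t h1 h2
    rw [h1, h2]
    exact hA (w t)
  · exact ((Lp.memLp (liftLp γ T ι w)).integrable_norm_pow (by norm_num)).const_mul _
  · exact (L2.integrable_inner (𝕜 := ℝ) (liftLp γ T A w) w).const_mul _

/-- The data of regular trajectories are dense. A pair `(v, ψ)` orthogonal to all of them is
tested with the derivative `J†ψ`, where `J` is integration in time: the accretivity of `J†`
and the coercivity of `A` give `J†ψ = 0`. -/
theorem denseRange_regularData {ι : V →L[ℝ] H} {A : V →L[ℝ] V} {lam : ℝ} (hι : DenseRange ι)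
    (hγ : 0 < γ) (hlam : 0 < lam) (hT : 0 ≤ T)
    (hA : ∀ u, lam * ‖u‖ ^ 2 ≤ γ * ‖ι u‖ ^ 2 + lam * inner ℝ (A u) u) :
    DenseRange (regularData ι A lam γ T) := by
  change Dense ((LinearMap.range (regularData ι A lam γ T).toLinearMap :
    Submodule ℝ (WithLp 2 (H × Lp V 2 (expMeasure γ T)))) :
      Set (WithLp 2 (H × Lp V 2 (expMeasure γ T))))
  rw [Submodule.dense_iff_topologicalClosure_eq_top,
    Submodule.topologicalClosure_eq_top_iff, Submodule.eq_bot_iff]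
  intro p hp
  set ψ := p.snd
  set J := primitiveLp V γ T
  set χ := ContinuousLinearMap.adjoint J ψ with hχ
  have horth : ∀ x : V × Lp V 2 (expMeasure γ T), inner ℝ (ι x.1) p.fst +
      inner ℝ (liftLp γ T (gram ι) x.2 + lam • liftLp γ T A (regularSol γ T x)) ψ = 0 := by
    intro x
    have h := (Submodule.mem_orthogonal _ _).1 hp _ ⟨x, rfl⟩
    rwa [WithLp.prod_inner_apply] at h
  have h0 : inner ℝ (liftLp γ T (gram ι) χ) ψ + lam * inner ℝ (liftLp γ T A χ) χ = 0 := by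
    have h := horth (0, χ)
    have h1 : regularSol γ T ((0 : V), χ) = J χ := by
      change constLp V γ T 0 + J χ = J χ
      rw [map_zero, zero_add]
    rw [h1, map_zero, inner_zero_left, zero_add, inner_add_left, real_inner_smul_left,
      ← primitiveLp_liftLp, ← ContinuousLinearMap.adjoint_inner_right J] at h
    exact h
  have hcomm : liftLp γ T ι χ =
      ContinuousLinearMap.adjoint (primitiveLp H γ T) (liftLp γ T ι ψ) := by
    have h : J.comp (ContinuousLinearMap.adjoint (liftLp γ T ι)) =
        (ContinuousLinearMap.adjoint (liftLp γ T ι)).comp (primitiveLp H γ T) := by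
      rw [adjoint_liftLp]
      ext1 w
      exact primitiveLp_liftLp _ w
    refine ext_inner_left ℝ fun u => ?_
    rw [ContinuousLinearMap.adjoint_inner_right, ← ContinuousLinearMap.adjoint_inner_left,
      hχ, ContinuousLinearMap.adjoint_inner_right,
      ← ContinuousLinearMap.adjoint_inner_left (liftLp γ T ι)]
    exact congrArg (inner ℝ · ψ) (DFunLike.congr_fun h u)
  have h1 : γ * ‖liftLp γ T ι χ‖ ^ 2 ≤ inner ℝ (liftLp γ T (gram ι) χ) ψ := by
    rw [inner_liftLp_gram, hcomm]
    exact mul_norm_adjoint_sq_le (S := primitiveLp H γ T) hγ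
      (fun z => mul_norm_primitiveLp_sq_le hT z) (liftLp γ T ι ψ)
  have h2 := coercive_liftLp hA χ
  have hχ0 : χ = 0 := by
    have h3 : lam * ‖χ‖ ^ 2 ≤ 0 := by linarith
    have h4 : ‖χ‖ ^ 2 ≤ 0 := by nlinarith
    exact norm_eq_zero.1 (pow_eq_zero_iff two_ne_zero |>.1 (le_antisymm h4 (sq_nonneg _)))
  have hψ : ψ = 0 := by
    have h3 : inner ℝ (J ψ) ψ = 0 := by
      rw [real_inner_comm, ← ContinuousLinearMap.adjoint_inner_left, ← hχ, hχ0, inner_zero_left]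
    have h4 := mul_norm_primitiveLp_sq_le hT ψ
    rw [h3] at h4
    have h5 : ‖J ψ‖ ^ 2 ≤ 0 := by nlinarith
    exact primitiveLp_injective
      (norm_eq_zero.1 (pow_eq_zero_iff two_ne_zero |>.1 (le_antisymm h5 (sq_nonneg _))))
  have hv : p.fst = 0 := by
    refine hι.eq_zero_of_inner_right ℝ fun v => ?_
    have h := horth (v, 0)
    rwa [hψ, inner_zero_right, add_zero] at h
  rw [WithLp.ext_iff]
  exact Prod.ext hv hψ

/-- The energy estimate for regular trajectories. -/
theorem regular_energy {ι : V →L[ℝ] H} {A : V →L[ℝ] V} {lam : ℝ}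
    (hlam : 0 < lam)
    (hA : ∀ u, lam * ‖u‖ ^ 2 ≤ γ * ‖ι u‖ ^ 2 + lam * inner ℝ (A u) u)
    (x : V × Lp V 2 (expMeasure γ T)) {t : ℝ} (ht : t ∈ Icc 0 T) :
    Real.exp (-(2 * γ) * t) * ‖regularSolBCF ι γ T x t‖ ^ 2 +
        lam * ∫ s in Ioo 0 t, Real.exp (-(2 * γ) * s) * ‖regularSol γ T x s‖ ^ 2 ≤
      ‖ι x.1‖ ^ 2 + lam⁻¹ * ‖(regularData ι A lam γ T x).snd‖ ^ 2 := by
  set w := regularSol γ T x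
  set F := (regularData ι A lam γ T x).snd
  have hF : F =ᵐ[expMeasure γ T] fun s => gram ι (x.2 s) + lam • A (w s) := by
    have h : F = liftLp γ T (gram ι) x.2 + lam • liftLp γ T A w := rfl
    rw [h]
    filter_upwards [Lp.coeFn_add (liftLp γ T (gram ι) x.2) (lam • liftLp γ T A w),
      Lp.coeFn_smul lam (liftLp γ T A w), coeFn_liftLp (gram ι) x.2, coeFn_liftLp A w]
      with s h1 h2 h3 h4
    rw [h1, Pi.add_apply, h2, Pi.smul_apply, h3, h4]
  have hE := weighted_energy (liftLp γ T ι x.2) (ι x.1) ht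
  have hint : ∀ w : Lp V 2 (expMeasure γ T), IntegrableOn
      (fun s => Real.exp (-(2 * γ) * s) * ‖w s‖ ^ 2) (Ioo 0 T) := by
    intro w
    have h : IntegrableOn (fun s => ‖w s‖ ^ 2) (Icc 0 T) := by
      rw [integrableOn_Icc_iff_integrableOn_Ioo]
      exact (Lp_memLp_restrict w).integrable_norm_pow (by norm_num)
    exact (h.continuousOn_mul (by fun_prop) isCompact_Icc).mono_set Ioo_subset_Icc_self
  have hLint : IntegrableOn (fun s => Real.exp (-(2 * γ) * s) *
        (2 * inner ℝ (ι x.1 + primitiveBCF H γ T (liftLp γ T ι x.2) s) (liftLp γ T ι x.2 s) -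
          2 * γ * ‖ι x.1 + primitiveBCF H γ T (liftLp γ T ι x.2) s‖ ^ 2)) (Ioo 0 T) := by
    set y := regularSolBCF ι γ T x with hy
    change IntegrableOn (fun s => Real.exp (-(2 * γ) * s) *
      (2 * inner ℝ (y s) (liftLp γ T ι x.2 s) - 2 * γ * ‖y s‖ ^ 2)) (Ioo 0 T)
    have hz := Lp_integrableOn (liftLp γ T ι x.2)
    have h1 : IntegrableOn (fun s => inner ℝ (y s) (liftLp γ T ι x.2 s)) (Ioo 0 T) :=
      Integrable.mono' (hz.norm.const_mul ‖y‖)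
        (y.continuous.aestronglyMeasurable.inner hz.aestronglyMeasurable)
        (ae_of_all _ fun s => (norm_inner_le_norm _ _).trans
          (mul_le_mul_of_nonneg_right (y.norm_coe_le_norm s) (norm_nonneg _)))
    have h2 : IntegrableOn (fun s => ‖y s‖ ^ 2) (Ioo 0 T) :=
      ((y.continuous.norm.pow 2).continuousOn.integrableOn_compact
        (isCompact_Icc (a := (0 : ℝ)) (b := T))).mono_set Ioo_subset_Icc_self
    have h3 : IntegrableOn (fun s => 2 * inner ℝ (y s) (liftLp γ T ι x.2 s) -
        2 * γ * ‖y s‖ ^ 2) (Icc 0 T) := by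
      rw [integrableOn_Icc_iff_integrableOn_Ioo]
      exact (h1.const_mul 2).sub (h2.const_mul (2 * γ))
    exact (h3.continuousOn_mul (by fun_prop) isCompact_Icc).mono_set Ioo_subset_Icc_self
  have hIt := Ioo_subset_Ioo_right (b := (0 : ℝ)) ht.2
  have h1 : ∫ s in (0 : ℝ)..t, Real.exp (-(2 * γ) * s) *
        (2 * inner ℝ (ι x.1 + primitiveBCF H γ T (liftLp γ T ι x.2) s) (liftLp γ T ι x.2 s) -
          2 * γ * ‖ι x.1 + primitiveBCF H γ T (liftLp γ T ι x.2) s‖ ^ 2) ≤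
      ∫ s in Ioo 0 t, (lam⁻¹ * (Real.exp (-(2 * γ) * s) * ‖F s‖ ^ 2) -
        lam * (Real.exp (-(2 * γ) * s) * ‖w s‖ ^ 2)) := by
    rw [intervalIntegral.integral_of_le ht.1, integral_Ioc_eq_integral_Ioo]
    refine setIntegral_mono_ae_restrict (hLint.mono_set hIt)
      ((((hint F).mono_set hIt).const_mul _).sub (((hint w).mono_set hIt).const_mul _)) ?_
    have hw := coeFn_regularSol x
    have hz := coeFn_liftLp ι x.2
    rw [EventuallyEq, ae_expMeasure] at hF hw hz
    refine ae_restrict_of_ae_restrict_of_subset hIt ?_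
    filter_upwards [hF, hw, hz] with s h1 h2 h3
    have h4 : ι x.1 + primitiveBCF H γ T (liftLp γ T ι x.2) s = ι (w s) := by
      rw [h2, map_add, primitiveBCF_liftLp]
    have h5 : inner ℝ (ι (w s)) (ι (x.2 s)) =
        inner ℝ (F s) (w s) - lam * inner ℝ (A (w s)) (w s) := by
      rw [h1, inner_add_left, inner_gram, real_inner_smul_left, real_inner_comm]
      ring
    rw [h4, h3, h5]
    have h6 := hA (w s)
    have h7 : 2 * inner ℝ (F s) (w s) ≤ lam⁻¹ * ‖F s‖ ^ 2 + lam * ‖w s‖ ^ 2 := by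
      have h8 := real_inner_le_norm (F s) (w s)
      have h9 : 0 ≤ lam⁻¹ * (‖F s‖ - lam * ‖w s‖) ^ 2 := by positivity
      have h10 : lam⁻¹ * (‖F s‖ - lam * ‖w s‖) ^ 2 =
          lam⁻¹ * ‖F s‖ ^ 2 - 2 * (‖F s‖ * ‖w s‖) + lam * ‖w s‖ ^ 2 := by
        field_simp
        ring
      linarith
    have h8 : 2 * (inner ℝ (F s) (w s) - lam * inner ℝ (A (w s)) (w s)) -
        2 * γ * ‖ι (w s)‖ ^ 2 ≤ lam⁻¹ * ‖F s‖ ^ 2 - lam * ‖w s‖ ^ 2 := by linarith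
    refine (mul_le_mul_of_nonneg_left h8 (Real.exp_pos _).le).trans (le_of_eq ?_)
    ring
  rw [integral_sub (((hint F).mono_set hIt).const_mul _) (((hint w).mono_set hIt).const_mul _),
    integral_const_mul, integral_const_mul, hE] at h1
  have h2 : ∫ s in Ioo 0 t, Real.exp (-(2 * γ) * s) * ‖F s‖ ^ 2 ≤ ‖F‖ ^ 2 := by
    rw [norm_sq_eq_integral, integral_expMeasure]
    exact setIntegral_mono_set (hint F) (ae_of_all _ fun s => by positivity) hIt.eventuallyLE
  have h3 : regularSolBCF ι γ T x t = ι x.1 + primitiveBCF H γ T (liftLp γ T ι x.2) t := rfl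
  rw [h3]
  have h4 := mul_le_mul_of_nonneg_left h2 (inv_nonneg.2 hlam.le)
  linarith

theorem norm_regularSol_le {ι : V →L[ℝ] H} {A : V →L[ℝ] V} {lam : ℝ}
    (hlam : 0 < lam) (hT : 0 ≤ T)
    (hA : ∀ u, lam * ‖u‖ ^ 2 ≤ γ * ‖ι u‖ ^ 2 + lam * inner ℝ (A u) u)
    (x : V × Lp V 2 (expMeasure γ T)) :
    ‖regularSol γ T x‖ ≤ (lam⁻¹ + 1) * ‖regularData ι A lam γ T x‖ := by
  have h := regular_energy hlam hA x (right_mem_Icc.2 hT)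
  have h1 : ∫ s in Ioo 0 T, Real.exp (-(2 * γ) * s) * ‖regularSol γ T x s‖ ^ 2 =
      ‖regularSol γ T x‖ ^ 2 := by
    rw [norm_sq_eq_integral, integral_expMeasure]
    rfl
  have h2 : 0 ≤ Real.exp (-(2 * γ) * T) * ‖regularSolBCF ι γ T x T‖ ^ 2 := by positivity
  have h3 := WithLp.prod_norm_sq_eq_of_L2 (regularData ι A lam γ T x)
  have h4 : ‖ι x.1‖ ^ 2 = ‖(regularData ι A lam γ T x).fst‖ ^ 2 := rfl
  refine le_of_sq_le_sq ?_ (by positivity)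
  rw [h1, h4] at h
  rw [mul_pow, h3]
  have h5 : ‖regularSol γ T x‖ ^ 2 ≤ lam⁻¹ * (‖(regularData ι A lam γ T x).fst‖ ^ 2 +
      lam⁻¹ * ‖(regularData ι A lam γ T x).snd‖ ^ 2) := by
    rw [inv_mul_eq_div, le_div_iff₀ hlam]
    linarith
  refine h5.trans ?_
  have h6 : 0 < lam⁻¹ := inv_pos.2 hlam
  have h7 : 0 ≤ ‖(regularData ι A lam γ T x).fst‖ ^ 2 := by positivity
  have h8 : 0 ≤ ‖(regularData ι A lam γ T x).snd‖ ^ 2 := by positivity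
  nlinarith [mul_nonneg h6.le h7, mul_nonneg h6.le h8, mul_nonneg (mul_nonneg h6.le h6.le) h7]

theorem norm_regularSolBCF_apply_le {ι : V →L[ℝ] H} {A : V →L[ℝ] V} {lam : ℝ}
    (hlam : 0 < lam) (hγ : 0 ≤ γ)
    (hA : ∀ u, lam * ‖u‖ ^ 2 ≤ γ * ‖ι u‖ ^ 2 + lam * inner ℝ (A u) u)
    (x : V × Lp V 2 (expMeasure γ T)) {t : ℝ} (ht : t ∈ Icc 0 T) :
    ‖regularSolBCF ι γ T x t‖ ≤
      Real.exp (γ * T) * (lam⁻¹ + 1) * ‖regularData ι A lam γ T x‖ := by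
  have h := regular_energy hlam hA x ht
  have h2 : 0 ≤ lam * ∫ s in Ioo 0 t, Real.exp (-(2 * γ) * s) * ‖regularSol γ T x s‖ ^ 2 :=
    mul_nonneg hlam.le (integral_nonneg fun s => by positivity)
  have h3 := WithLp.prod_norm_sq_eq_of_L2 (regularData ι A lam γ T x)
  have h4 : ‖ι x.1‖ ^ 2 = ‖(regularData ι A lam γ T x).fst‖ ^ 2 := rfl
  refine le_of_sq_le_sq ?_ (by positivity)
  rw [h4] at h
  have h5 : Real.exp (γ * T) ^ 2 * Real.exp (-(2 * γ) * T) = 1 := by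
    rw [← Real.exp_nat_mul, ← Real.exp_add, Real.exp_eq_one_iff]
    push_cast
    ring
  have h6 : Real.exp (-(2 * γ) * T) ≤ Real.exp (-(2 * γ) * t) := by
    refine Real.exp_le_exp.2 ?_
    nlinarith [ht.2]
  have h7 : Real.exp (-(2 * γ) * T) * ‖regularSolBCF ι γ T x t‖ ^ 2 ≤
      (lam⁻¹ + 1) ^ 2 * ‖regularData ι A lam γ T x‖ ^ 2 := by
    rw [h3]
    have h6 := mul_le_mul_of_nonneg_right h6 (sq_nonneg ‖regularSolBCF ι γ T x t‖)
    have h9 : 0 < lam⁻¹ := inv_pos.2 hlam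
    have h7 : 0 ≤ ‖(regularData ι A lam γ T x).fst‖ ^ 2 := by positivity
    have h8 : 0 ≤ ‖(regularData ι A lam γ T x).snd‖ ^ 2 := by positivity
    nlinarith [mul_nonneg h9.le h7, mul_nonneg h9.le h8, mul_nonneg (mul_nonneg h9.le h9.le) h7,
      mul_nonneg (mul_nonneg h9.le h9.le) h8]
  calc ‖regularSolBCF ι γ T x t‖ ^ 2
      = Real.exp (γ * T) ^ 2 * (Real.exp (-(2 * γ) * T) * ‖regularSolBCF ι γ T x t‖ ^ 2) := by
        rw [← mul_assoc, h5, one_mul]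
    _ ≤ Real.exp (γ * T) ^ 2 * ((lam⁻¹ + 1) ^ 2 * ‖regularData ι A lam γ T x‖ ^ 2) := by gcongr
    _ = _ := by ring

theorem norm_regularSolBCF_le {ι : V →L[ℝ] H} {A : V →L[ℝ] V} {lam : ℝ}
    (hlam : 0 < lam) (hγ : 0 ≤ γ) (hT : 0 ≤ T)
    (hA : ∀ u, lam * ‖u‖ ^ 2 ≤ γ * ‖ι u‖ ^ 2 + lam * inner ℝ (A u) u)
    (x : V × Lp V 2 (expMeasure γ T)) :
    ‖regularSolBCF ι γ T x‖ ≤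
      Real.exp (γ * T) * (lam⁻¹ + 1) * ‖regularData ι A lam γ T x‖ := by
  refine (BoundedContinuousFunction.norm_le (by positivity)).2 fun t => ?_
  obtain ⟨s, hs, h⟩ := exists_primitiveBCF_eq (liftLp γ T ι x.2) hT t
  have h1 : regularSolBCF ι γ T x t = regularSolBCF ι γ T x s := congrArg (ι x.1 + ·) h
  rw [h1]
  exact norm_regularSolBCF_apply_le hlam hγ hA x hs

/-- A linear map that is bounded relative to an operator with dense range factors through it. -/
theorem exists_factor_of_bound {E G F : Type*} [AddCommGroup E] [Module ℝ E]
    [NormedAddCommGroup G] [NormedSpace ℝ G] [NormedAddCommGroup F] [NormedSpace ℝ F]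
    [CompleteSpace F] (e : E →ₗ[ℝ] G) (f : E →ₗ[ℝ] F) (hd : DenseRange e) (C : ℝ)
    (h : ∀ x, ‖f x‖ ≤ C * ‖e x‖) :
    ∃ S : G →L[ℝ] F, (∀ x, S (e x) = f x) ∧ ∀ y, ‖S y‖ ≤ C * ‖y‖ :=
  ⟨f.extendOfNorm e, LinearMap.extendOfNorm_eq hd ⟨C, h⟩,
    LinearMap.norm_extendOfNorm_apply_le hd C h⟩

/-- Well-posedness of the linear problem `w' + lam A w = F`, `w(0) = v₀`, in integrated form: the
solution operators to `L²(0, T; V)` and to `C([0, T]; H)`, by continuous extension from the regular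
trajectories. -/
theorem exists_linear_solution {ι : V →L[ℝ] H} {A : V →L[ℝ] V} {lam : ℝ} (hι : DenseRange ι)
    (hlam : 0 < lam) (hγ : 0 < γ) (hT : 0 ≤ T)
    (hA : ∀ u, lam * ‖u‖ ^ 2 ≤ γ * ‖ι u‖ ^ 2 + lam * inner ℝ (A u) u) :
    ∃ (S : WithLp 2 (H × Lp V 2 (expMeasure γ T)) →L[ℝ] Lp V 2 (expMeasure γ T))
      (R : WithLp 2 (H × Lp V 2 (expMeasure γ T)) →L[ℝ] BoundedContinuousFunction ℝ H),
      (∀ x, ‖S x‖ ≤ (lam⁻¹ + 1) * ‖x‖) ∧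
      (∀ x, ‖R x‖ ≤ Real.exp (γ * T) * (lam⁻¹ + 1) * ‖x‖) ∧
      (∀ x, liftLp γ T (gram ι) (S x) + lam • primitiveLp V γ T (liftLp γ T A (S x)) =
        constLp V γ T (ContinuousLinearMap.adjoint ι x.fst) + primitiveLp V γ T x.snd) ∧
      (∀ x, R x =ᵐ[expMeasure γ T] fun t => ι (S x t)) ∧ ∀ x, R x 0 = x.fst := by
  have hd := denseRange_regularData hι hγ hlam hT hA
  obtain ⟨S, hSe, hS⟩ := exists_factor_of_bound (regularData ι A lam γ T).toLinearMap
    (regularSol γ T).toLinearMap hd _ (norm_regularSol_le hlam hT hA)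
  obtain ⟨R, hRe, hR⟩ := exists_factor_of_bound (regularData ι A lam γ T).toLinearMap
    (regularSolBCF ι γ T) hd _ (norm_regularSolBCF_le hlam hγ.le hT hA)
  simp only [ContinuousLinearMap.coe_coe] at hSe hRe
  have hfst : Continuous fun x : WithLp 2 (H × Lp V 2 (expMeasure γ T)) => x.fst :=
    (WithLp.fstL 2 ℝ H (Lp V 2 (expMeasure γ T))).continuous
  have hsnd : Continuous fun x : WithLp 2 (H × Lp V 2 (expMeasure γ T)) => x.snd :=
    (WithLp.sndL 2 ℝ H (Lp V 2 (expMeasure γ T))).continuous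
  refine ⟨S, R, hS, hR, fun x => ?_, fun x => ?_, fun x => ?_⟩
  · refine hd.induction_on (p := fun x => liftLp γ T (gram ι) (S x) +
        lam • primitiveLp V γ T (liftLp γ T A (S x)) =
        constLp V γ T (ContinuousLinearMap.adjoint ι x.fst) + primitiveLp V γ T x.snd) x
      (isClosed_eq (by fun_prop) (by fun_prop)) fun y => ?_
    have h1 : (regularData ι A lam γ T y).fst = ι y.1 := rfl
    have h2 : (regularData ι A lam γ T y).snd =
      liftLp γ T (gram ι) y.2 + lam • liftLp γ T A (regularSol γ T y) := rfl
    have h3 : regularSol γ T y = constLp V γ T y.1 + primitiveLp V γ T y.2 := rfl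
    rw [hSe, h1, h2, map_add, map_smul, ← add_assoc, primitiveLp_liftLp (gram ι) y.2, h3, map_add,
      liftLp_constLp]
    rfl
  · have h : BoundedContinuousFunction.toLp 2 (expMeasure γ T) ℝ (R x) = liftLp γ T ι (S x) := by
      refine hd.induction_on (p := fun x => BoundedContinuousFunction.toLp 2 (expMeasure γ T) ℝ
        (R x) = liftLp γ T ι (S x)) x (isClosed_eq (by fun_prop) (by fun_prop)) fun y => ?_
      rw [hSe, hRe]
      ext1
      filter_upwards [BoundedContinuousFunction.coeFn_toLp 2 (expMeasure γ T) ℝ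
        (regularSolBCF ι γ T y), coeFn_liftLp ι (regularSol γ T y), coeFn_regularSol y]
        with t h1 h2 h3
      rw [h1, h2, h3, regularSolBCF_apply]
    filter_upwards [BoundedContinuousFunction.coeFn_toLp 2 (expMeasure γ T) ℝ (R x),
      coeFn_liftLp ι (S x)] with t h1 h2
    rw [← h1, h, h2]
  · refine hd.induction_on (p := fun x => R x 0 = x.fst) x
      (isClosed_eq ((BoundedContinuousFunction.evalCLM ℝ (0 : ℝ)).continuous.comp R.continuous)
        hfst) fun y => ?_
    rw [hRe, regularSolBCF_apply, primitiveBCF_zero, add_zero]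
    rfl

end Linear

/-! ### The semilinear equation by contraction -/

section Semilinear

variable {V H : Type*} [NormedAddCommGroup V] [InnerProductSpace ℝ V] [CompleteSpace V]
  [NormedAddCommGroup H] [InnerProductSpace ℝ H] [CompleteSpace H]
  {ι : V →L[ℝ] H} {A : V →L[ℝ] V} {lam γ T : ℝ}

theorem norm_toLp_two_le {E F : Type*} [NormedAddCommGroup E] [InnerProductSpace ℝ E]
    [NormedAddCommGroup F] [InnerProductSpace ℝ F] (a : E) (b : F) :
    ‖WithLp.toLp 2 (a, b)‖ ≤ ‖a‖ + ‖b‖ := by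
  refine le_of_sq_le_sq ?_ (by positivity)
  rw [WithLp.prod_norm_sq_eq_of_L2]
  change ‖a‖ ^ 2 + ‖b‖ ^ 2 ≤ _
  nlinarith [mul_nonneg (norm_nonneg a) (norm_nonneg b)]

omit [CompleteSpace V] in
theorem norm_liftLp_le {α : ℝ} (hα : 0 ≤ α) (hA : ∀ u, ‖A u‖ ≤ α * ‖u‖)
    (w : Lp V 2 (expMeasure γ T)) : ‖liftLp γ T A w‖ ≤ α * ‖w‖ :=
  ((liftLp γ T A).le_opNorm w).trans (mul_le_mul_of_nonneg_right
    ((A.norm_compLpL_le).trans (A.opNorm_le_bound hα hA)) (norm_nonneg w))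

/-- Existence for `w' + lam A w + A η = N η`, `η = u₀ + ∫₀ᵗ w`, `w(0) = v₀`, with a Lipschitz
operator `N` on `L²(0, T; V)`. The memory term and `N` enter through `η` only, and integration in
time has norm at most `1 / γ` for the weight `γ`, so that the solution map of the linear problem
leads to a contraction with constant `1 / 2`. -/
theorem exists_semilinear_solution (hι : DenseRange ι) (hlam : 0 < lam) (hγ : 0 < γ) (hT : 0 ≤ T)
    (hA : ∀ u, lam * ‖u‖ ^ 2 ≤ γ * ‖ι u‖ ^ 2 + lam * inner ℝ (A u) u)
    {α K : ℝ} (hα : 0 ≤ α) (hK : 0 ≤ K) (hAα : ∀ u, ‖A u‖ ≤ α * ‖u‖)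
    (hsmall : 2 * ((lam⁻¹ + 1) * (K + α)) ≤ γ)
    {N : Lp V 2 (expMeasure γ T) → Lp V 2 (expMeasure γ T)}
    (hN : ∀ u v, ‖N u - N v‖ ≤ K * ‖u - v‖) (u₀ : V) (v₀ : H) :
    ∃ (w : Lp V 2 (expMeasure γ T)) (W : BoundedContinuousFunction ℝ H),
      liftLp γ T (gram ι) w = constLp V γ T (ContinuousLinearMap.adjoint ι v₀) +
        primitiveLp V γ T (N (constLp V γ T u₀ + primitiveLp V γ T w) -
          liftLp γ T A (constLp V γ T u₀ + primitiveLp V γ T w) - lam • liftLp γ T A w) ∧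
      W =ᵐ[expMeasure γ T] (fun t => ι (w t)) ∧ W 0 = v₀ ∧
      ‖w‖ ≤ 2 * ((lam⁻¹ + 1) * (‖v₀‖ + ‖N 0‖ + (K + α) * (√|T| * ‖u₀‖))) ∧
      ∀ t, ‖W t‖ ≤ Real.exp (γ * T) *
        (2 * ((lam⁻¹ + 1) * (‖v₀‖ + ‖N 0‖ + (K + α) * (√|T| * ‖u₀‖)))) := by
  obtain ⟨S, R, hS, hR, heq, hae, hR0⟩ := exists_linear_solution hι hlam hγ hT hA
  set J := primitiveLp V γ T
  set c := lam⁻¹ + 1 with hc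
  have hc0 : 0 < c := by positivity
  set η : Lp V 2 (expMeasure γ T) → Lp V 2 (expMeasure γ T) :=
    fun w => constLp V γ T u₀ + J w with hη
  set G : Lp V 2 (expMeasure γ T) → Lp V 2 (expMeasure γ T) :=
    fun u => N u - liftLp γ T A u with hG
  have hGlip : ∀ u v, ‖G u - G v‖ ≤ (K + α) * ‖u - v‖ := by
    intro u v
    have h : G u - G v = (N u - N v) - liftLp γ T A (u - v) := by
      simp only [hG, map_sub]
      abel
    rw [h, add_mul]
    exact (norm_sub_le _ _).trans (add_le_add (hN u v) (norm_liftLp_le hα hAα _))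
  have hJ : ∀ w, ‖J w‖ ≤ γ⁻¹ * ‖w‖ := norm_primitiveLp_le hT hγ
  have hsm : c * ((K + α) * γ⁻¹) ≤ 1 / 2 := by
    rw [← mul_assoc, ← div_eq_mul_inv, div_le_iff₀ hγ]
    linarith
  set Φ : Lp V 2 (expMeasure γ T) → Lp V 2 (expMeasure γ T) :=
    fun w => S (WithLp.toLp 2 (v₀, G (η w))) with hΦ
  have hlip : LipschitzWith (1 / 2) Φ := by
    refine LipschitzWith.of_dist_le_mul fun u v => ?_
    rw [dist_eq_norm, dist_eq_norm]
    have h1 : Φ u - Φ v = S (WithLp.toLp 2 ((0 : H), G (η u) - G (η v))) := by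
      simp only [hΦ]
      rw [← map_sub, ← WithLp.toLp_sub, Prod.mk_sub_mk, sub_self]
    have h2 : η u - η v = J (u - v) := by
      simp only [hη, map_sub]
      abel
    have h3 : ‖WithLp.toLp 2 ((0 : H), G (η u) - G (η v))‖ ≤ (K + α) * (γ⁻¹ * ‖u - v‖) := by
      refine (norm_toLp_two_le _ _).trans ?_
      rw [norm_zero, zero_add]
      refine (hGlip _ _).trans ?_
      rw [h2]
      exact mul_le_mul_of_nonneg_left (hJ _) (by positivity)
    rw [h1]
    refine (hS _).trans ((mul_le_mul_of_nonneg_left h3 hc0.le).trans ?_)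
    have h4 := mul_le_mul_of_nonneg_right hsm (norm_nonneg (u - v))
    refine le_trans (le_of_eq (by ring)) (h4.trans (le_of_eq ?_))
    norm_num
  have hcw : ContractingWith (1 / 2) Φ := ⟨by norm_num, hlip⟩
  set w := hcw.fixedPoint Φ
  have hw : Φ w = w := hcw.fixedPoint_isFixedPt
  set x := WithLp.toLp 2 (v₀, G (η w)) with hx
  have hSx : S x = w := hw
  set D := ‖v₀‖ + ‖N 0‖ + (K + α) * (√|T| * ‖u₀‖)
  have hxn : ‖x‖ ≤ D + (K + α) * (γ⁻¹ * ‖w‖) := by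
    have h1 : ‖G (η w)‖ ≤ ‖N 0‖ + (K + α) * ‖η w‖ := by
      have h := hGlip (η w) 0
      have h0 : G 0 = N 0 := by simp only [hG, map_zero, sub_zero]
      rw [h0, sub_zero] at h
      have h' := norm_sub_norm_le (G (η w)) (N 0)
      linarith
    have h2 : ‖η w‖ ≤ √|T| * ‖u₀‖ + γ⁻¹ * ‖w‖ :=
      (norm_add_le _ _).trans (add_le_add (norm_constLp_le hγ.le u₀) (hJ w))
    have h3 := mul_le_mul_of_nonneg_left h2 (add_nonneg hK hα)
    have h4 := norm_toLp_two_le v₀ (G (η w))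
    rw [mul_add] at h3
    linarith
  have hcx : c * ‖x‖ ≤ c * D + 1 / 2 * ‖w‖ := by
    have h1 := mul_le_mul_of_nonneg_left hxn hc0.le
    have h2 := mul_le_mul_of_nonneg_right hsm (norm_nonneg w)
    linarith
  have hwn : ‖w‖ ≤ 2 * (c * D) := by
    have h := hS x
    rw [hSx] at h
    linarith
  refine ⟨w, R x, ?_, ?_, hR0 x, hwn, fun t => ?_⟩
  · have h := heq x
    rw [hSx] at h
    rw [map_sub, map_smul, ← add_sub_assoc]
    exact eq_sub_of_add_eq h
  · have h := hae x
    rwa [hSx] at h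
  · refine ((R x).norm_coe_le_norm t).trans ((hR x).trans ?_)
    rw [mul_assoc]
    refine mul_le_mul_of_nonneg_left ?_ (Real.exp_pos _).le
    linarith

/-- Uniqueness, in terms of the difference `w` of two velocities: the equation is tested with the
difference `J w` of the positions, which needs no regularity of `w`. -/
theorem primitiveLp_eq_zero_of_eq (hγ : 0 < γ) (hT : 0 ≤ T)
    (hA : ∀ u, lam * ‖u‖ ^ 2 ≤ γ * ‖ι u‖ ^ 2 + lam * inner ℝ (A u) u)
    {κ : ℝ} (hκ : κ < lam * γ) {w G : Lp V 2 (expMeasure γ T)}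
    (hw : liftLp γ T (gram ι) w = primitiveLp V γ T (G - lam • liftLp γ T A w))
    (hG : ‖G‖ ≤ κ * ‖primitiveLp V γ T w‖) : primitiveLp V γ T w = 0 := by
  set J := primitiveLp V γ T
  have h1 : γ * ‖liftLp γ T ι (J w)‖ ^ 2 ≤ inner ℝ (liftLp γ T (gram ι) w) (J w) := by
    rw [inner_liftLp_gram, ← primitiveLp_liftLp, real_inner_comm]
    exact mul_norm_primitiveLp_sq_le hT _
  have h2 := coercive_liftLp hA (J w)
  rw [hw, map_sub, map_smul, primitiveLp_liftLp A w, inner_sub_left, real_inner_smul_left] at h1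
  have h3 : inner ℝ (J G) (J w) ≤ γ⁻¹ * (κ * ‖J w‖) * ‖J w‖ :=
    (real_inner_le_norm _ _).trans (mul_le_mul_of_nonneg_right
      ((norm_primitiveLp_le hT hγ G).trans (mul_le_mul_of_nonneg_left hG (inv_nonneg.2 hγ.le)))
      (norm_nonneg _))
  have h4 : (lam - γ⁻¹ * κ) * ‖J w‖ ^ 2 ≤ 0 := by
    have h5 : γ⁻¹ * (κ * ‖J w‖) * ‖J w‖ = γ⁻¹ * κ * ‖J w‖ ^ 2 := by ring
    rw [h5] at h3
    linarith
  have h5 : 0 < lam - γ⁻¹ * κ := by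
    rw [sub_pos, inv_mul_eq_div, div_lt_iff₀ hγ]
    exact hκ
  have h6 : ‖J w‖ ^ 2 ≤ 0 := by
    by_contra hcon
    exact absurd h4 (not_le.2 (mul_pos h5 (not_le.1 hcon)))
  exact norm_eq_zero.1 (pow_eq_zero_iff two_ne_zero |>.1 (le_antisymm h6 (sq_nonneg _)))

end Semilinear

/-! ### Weak derivatives on an interval -/

section WeakDerivative

variable {X : Type*} [NormedAddCommGroup X] [NormedSpace ℝ X] {I : Set ℝ}

theorem IsTestFunction.integrableOn_smul {φ : ℝ → ℝ} (hφ : IsTestFunction I φ) {u : ℝ → X}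
    (hu : LocallyIntegrableOn u I) : IntegrableOn (fun x => φ x • u x) I := by
  have h : IntegrableOn (fun x => φ x • u x) (tsupport φ) :=
    (hu.integrableOn_compact_subset hφ.support hφ.compact).continuousOn_smul
      hφ.smooth.continuous.continuousOn hφ.compact
  refine ((integrableOn_iff_integrable_of_support_subset fun x hx => ?_).1 h).integrableOn
  exact subset_tsupport φ fun h0 => hx (by simp [h0])

theorem IsTestFunction.deriv {φ : ℝ → ℝ} (hφ : IsTestFunction I φ) :
    IsTestFunction I (deriv φ) :=
  ⟨(contDiff_infty_iff_deriv.1 hφ.smooth).2, hφ.compact.deriv,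
    (closure_minimal (support_deriv_subset) (isClosed_tsupport φ)).trans hφ.support⟩

/-- The support of a test function on an interval lies strictly between two of its points. -/
theorem IsTestFunction.exists_support_subset (hI : IsOpen I) (hne : I.Nonempty) {φ : ℝ → ℝ}
    (hφ : IsTestFunction I φ) : ∃ a ∈ I, ∃ b ∈ I, a ≤ b ∧ tsupport φ ⊆ Ioo a b := by
  rcases (tsupport φ).eq_empty_or_nonempty with h | h
  · obtain ⟨a, ha⟩ := hne
    exact ⟨a, ha, a, ha, le_rfl, by simp [h]⟩
  have hc : IsCompact (tsupport φ) := hφ.compact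
  have h1 := hφ.support (hc.sInf_mem h)
  have h2 := hφ.support (hc.sSup_mem h)
  obtain ⟨ε, hε, hb1⟩ := Metric.isOpen_iff.1 hI _ h1
  obtain ⟨δ, hδ, hb2⟩ := Metric.isOpen_iff.1 hI _ h2
  have hsub : ∀ x ∈ tsupport φ, sInf (tsupport φ) ≤ x ∧ x ≤ sSup (tsupport φ) := fun x hx =>
    ⟨csInf_le hc.bddBelow hx, le_csSup hc.bddAbove hx⟩
  refine ⟨sInf (tsupport φ) - ε / 2, hb1 ?_, sSup (tsupport φ) + δ / 2, hb2 ?_, ?_, fun x hx => ?_⟩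
  · rw [Metric.mem_ball, Real.dist_eq, sub_sub_cancel_left, abs_neg, abs_of_pos (half_pos hε)]
    exact half_lt_self hε
  · rw [Metric.mem_ball, Real.dist_eq, add_sub_cancel_left, abs_of_pos (half_pos hδ)]
    exact half_lt_self hδ
  · obtain ⟨x, hx⟩ := h
    linarith [hsub x hx]
  · exact ⟨by linarith [hsub x hx], by linarith [hsub x hx]⟩

theorem HasWeakDeriv.congr_left {u v w : ℝ → X} (h : HasWeakDeriv I u w)
    (huv : u =ᵐ[volume.restrict I] v) : HasWeakDeriv I v w := by
  intro φ hφ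
  rw [← h φ hφ]
  refine integral_congr_ae ?_
  filter_upwards [huv] with x hx
  rw [hx]

variable [CompleteSpace X]

theorem hasWeakDeriv_of_sub_eq_integral (hI : IsOpen I) (hc : I.OrdConnected) {P w : ℝ → X}
    (hw : LocallyIntegrableOn w I)
    (hP : ∀ x ∈ I, ∀ y ∈ I, P y - P x = ∫ s in x..y, w s) : HasWeakDeriv I P w := by
  intro φ hφ
  rcases I.eq_empty_or_nonempty with rfl | hne
  · simp
  obtain ⟨a, ha, b, hb, hab, hsub⟩ := hφ.exists_support_subset hI hne
  have hIcc : Icc a b ⊆ I := hc.out ha hb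
  have hwab : IntervalIntegrable w volume a b :=
    (intervalIntegrable_iff_integrableOn_Icc_of_le hab).2
      (hw.integrableOn_compact_subset hIcc isCompact_Icc)
  have hset : ∀ g : ℝ → X, (∀ x, x ∉ tsupport φ → g x = 0) →
      ∫ x in I, g x = ∫ x in a..b, g x := by
    intro g hg
    rw [intervalIntegral.integral_of_le hab]
    refine setIntegral_eq_of_subset_of_forall_sdiff_eq_zero hI.measurableSet
      (Ioc_subset_Icc_self.trans hIcc) fun x hx => hg x fun hx' => hx.2 ?_
    exact Ioo_subset_Ioc_self (hsub hx')
  have hφ0 : ∀ x, x ∉ tsupport φ → φ x = 0 := fun x hx => image_eq_zero_of_notMem_tsupport hx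
  have hφ1 : ∀ x, x ∉ tsupport φ → deriv φ x = 0 := fun x hx =>
    image_eq_zero_of_notMem_tsupport fun h =>
      hx (closure_minimal support_deriv_subset (isClosed_tsupport φ) h)
  have hPab : ∀ x ∈ uIcc a b, P x = P a + ∫ s in a..x, w s := by
    intro x hx
    rw [uIcc_of_le hab] at hx
    rw [← hP a ha x (hIcc hx), add_sub_cancel]
  have h := integral_deriv_smul_primitive (hφ.smooth.of_le (by simp)) hwab left_mem_uIcc (P a)
  rw [hφ0 a fun h => (hsub h).1.false, hφ0 b fun h => (hsub h).2.false, zero_smul, zero_smul,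
    sub_zero] at h
  have hPc : ContinuousOn P (uIcc a b) :=
    (absolutelyContinuous_primitive hwab left_mem_uIcc (P a)).continuousOn.congr hPab
  rw [hset _ fun x hx => by rw [hφ1 x hx, zero_smul],
    hset _ fun x hx => by rw [hφ0 x hx, zero_smul], eq_neg_iff_add_eq_zero,
    ← intervalIntegral.integral_add
      (((hφ.smooth.continuous_deriv (by simp)).continuousOn.fun_smul hPc).intervalIntegrable)
      (hwab.continuousOn_smul hφ.smooth.continuous.continuousOn), ← h]
  refine intervalIntegral.integral_congr fun x hx => ?_
  simp only [hPab x hx]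

/-- A test function on an interval whose integral vanishes is the derivative of a test function. -/
theorem IsTestFunction.exists_deriv_eq (hI : IsOpen I) (hc : I.OrdConnected) (hne : I.Nonempty)
    {φ : ℝ → ℝ} (hφ : IsTestFunction I φ) (h0 : ∫ x, φ x = 0) :
    ∃ θ : ℝ → ℝ, IsTestFunction I θ ∧ _root_.deriv θ = φ := by
  obtain ⟨a, ha, b, hb, hab, hsub⟩ := hφ.exists_support_subset hI hne
  have hφ0 : ∀ x, x ∉ Ioo a b → φ x = 0 := fun x hx =>
    image_eq_zero_of_notMem_tsupport fun h => hx (hsub h)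
  have hd : ∀ x, HasDerivAt (fun x => ∫ s in a..x, φ s) (φ x) x := fun x =>
    intervalIntegral.integral_hasDerivAt_right (hφ.smooth.continuous.intervalIntegrable _ _)
      (hφ.smooth.continuous.stronglyMeasurableAtFilter _ _) hφ.smooth.continuous.continuousAt
  have hde : _root_.deriv (fun x => ∫ s in a..x, φ s) = φ := funext fun x => (hd x).deriv
  have hz : ∀ x, x ∉ Icc a b → ∫ s in a..x, φ s = 0 := by
    intro x hx
    rcases lt_or_ge x a with h | h
    · refine (intervalIntegral.integral_congr (g := fun _ => 0) fun s hs => ?_).trans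
        intervalIntegral.integral_zero
      rw [uIcc_of_ge h.le] at hs
      exact hφ0 s fun h' => h'.1.not_ge hs.2
    · have hbx : b < x := not_le.1 fun h' => hx ⟨h, h'⟩
      rw [intervalIntegral.integral_of_le h, ← h0]
      refine setIntegral_eq_integral_of_forall_compl_eq_zero fun s hs => hφ0 s fun h' => hs ?_
      exact ⟨h'.1, h'.2.le.trans hbx.le⟩
  have hts : tsupport (fun x => ∫ s in a..x, φ s) ⊆ Icc a b :=
    closure_minimal (fun x hx => not_not.1 fun h => hx (hz x h)) isClosed_Icc
  refine ⟨_, ⟨contDiff_infty_iff_deriv.2 ⟨fun x => (hd x).differentiableAt, ?_⟩, ?_, ?_⟩, hde⟩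
  · rw [hde]; exact hφ.smooth
  · exact isCompact_Icc.of_isClosed_subset (isClosed_tsupport _) hts
  · exact hts.trans (hc.out ha hb)

theorem exists_isTestFunction_integral_eq_one (hI : IsOpen I) (hne : I.Nonempty) :
    ∃ ψ : ℝ → ℝ, IsTestFunction I ψ ∧ ∫ x, ψ x = 1 := by
  obtain ⟨c, hcI⟩ := hne
  obtain ⟨ε, hε, hball⟩ := Metric.isOpen_iff.1 hI c hcI
  let f : ContDiffBump c := ⟨ε / 4, ε / 2, by positivity, by linarith⟩
  refine ⟨f.normed volume, ⟨f.contDiff_normed, f.hasCompactSupport_normed, ?_⟩,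
    f.integral_normed⟩
  rw [f.tsupport_normed_eq]
  exact (Metric.closedBall_subset_ball (by change ε / 2 < ε; linarith)).trans hball

/-- The lemma of du Bois-Reymond: a function with locally integrable weak derivative `w` on an
interval is a primitive of `w`, up to a constant and a null set. -/
theorem HasWeakDeriv.exists_ae_eq_add (hI : IsOpen I) (hc : I.OrdConnected) {u w P : ℝ → X}
    (hu : LocallyIntegrableOn u I) (hw : LocallyIntegrableOn w I) (h : HasWeakDeriv I u w)
    (hPc : ContinuousOn P I) (hP : ∀ x ∈ I, ∀ y ∈ I, P y - P x = ∫ s in x..y, w s) :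
    ∃ C : X, ∀ᵐ x ∂volume.restrict I, u x = C + P x := by
  rcases I.eq_empty_or_nonempty with rfl | hne
  · exact ⟨0, by simp⟩
  have hPl : LocallyIntegrableOn P I := hPc.locallyIntegrableOn hI.measurableSet
  have hPw := hasWeakDeriv_of_sub_eq_integral hI hc hw hP
  obtain ⟨ψ, hψ, hψ1⟩ := exists_isTestFunction_integral_eq_one hI hne
  set d : ℝ → X := fun x => u x - P x with hd
  have hdl : LocallyIntegrableOn d I := hu.sub hPl
  have hzero : ∀ φ : ℝ → ℝ, IsTestFunction I φ → ∫ x in I, deriv φ x • d x = 0 := by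
    intro φ hφ
    have h1 : ∀ x, deriv φ x • d x = deriv φ x • u x - deriv φ x • P x := fun x => smul_sub _ _ _
    simp only [h1]
    rw [integral_sub (hφ.deriv.integrableOn_smul hu) (hφ.deriv.integrableOn_smul hPl), h φ hφ,
      hPw φ hφ, sub_self]
  have hint : ∀ φ : ℝ → ℝ, IsTestFunction I φ → ∫ x in I, φ x = ∫ x, φ x := fun φ hφ =>
    setIntegral_eq_integral_of_forall_compl_eq_zero fun x hx =>
      image_eq_zero_of_notMem_tsupport fun hx' => hx (hφ.support hx')
  set C := ∫ x in I, ψ x • d x with hC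
  refine ⟨C, ?_⟩
  have key : ∀ φ : ℝ → ℝ, IsTestFunction I φ → ∫ x in I, φ x • (d x - C) = 0 := by
    intro φ hφ
    have hi : ∀ φ : ℝ → ℝ, IsTestFunction I φ → Integrable φ := fun φ hφ =>
      hφ.smooth.continuous.integrable_of_hasCompactSupport hφ.compact
    have ht : IsTestFunction I (φ + (-(∫ x, φ x)) • ψ) := hφ.add (hψ.smul _)
    obtain ⟨θ, hθ, hθd⟩ := ht.exists_deriv_eq hI hc hne (by
      simp only [Pi.add_apply, Pi.smul_apply, smul_eq_mul]
      rw [integral_add (hi φ hφ) ((hi ψ hψ).const_mul _), integral_const_mul, hψ1]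
      ring)
    have h1 := hzero θ hθ
    rw [hθd] at h1
    have h2 : ∀ x, (φ + (-(∫ x, φ x)) • ψ) x • d x =
        φ x • d x - (∫ x, φ x) • (ψ x • d x) := by
      intro x
      rw [Pi.add_apply, Pi.smul_apply, smul_eq_mul, add_smul, mul_smul, neg_smul, sub_eq_add_neg]
    simp only [h2] at h1
    rw [integral_sub (hφ.integrableOn_smul hdl) ((hψ.integrableOn_smul hdl).fun_smul _),
      integral_smul] at h1
    simp only [smul_sub]
    rw [integral_sub (hφ.integrableOn_smul hdl) ((hi φ hφ).integrableOn.smul_const C),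
      integral_smul_const, hint φ hφ]
    exact h1
  have hfin := hI.ae_eq_zero_of_integral_contDiff_smul_eq_zero (f := fun x => d x - C) (μ := volume)
    (hdl.sub (continuousOn_const.locallyIntegrableOn hI.measurableSet)) fun g h1 h2 h3 => by
      rw [← key g ⟨h1, h2, h3⟩]
      refine (setIntegral_eq_integral_of_forall_compl_eq_zero fun x hx => ?_).symm
      rw [image_eq_zero_of_notMem_tsupport fun hx' => hx (h3 hx'), zero_smul]
  rw [ae_restrict_iff' hI.measurableSet]
  filter_upwards [hfin] with x hx hxI
  rw [← sub_eq_zero.1 (hx hxI)]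
  simp [hd]

end WeakDerivative

/-! ### Riesz representation and Nemytskii operators -/

/-- The Riesz isomorphism of a real Hilbert space with its dual. It is `InnerProductSpace.toDual`,
which is semilinear over the conjugation of `ℝ`, as a linear map. -/
def riesz (X : Type*) [NormedAddCommGroup X] [InnerProductSpace ℝ X] [CompleteSpace X] :
    X ≃ₗᵢ[ℝ] StrongDual ℝ X where
  toFun := InnerProductSpace.toDual ℝ X
  map_add' := map_add _
  map_smul' c x := by simp
  invFun := (InnerProductSpace.toDual ℝ X).symm
  left_inv := (InnerProductSpace.toDual ℝ X).left_inv
  right_inv := (InnerProductSpace.toDual ℝ X).right_inv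
  norm_map' := (InnerProductSpace.toDual ℝ X).norm_map

theorem riesz_apply {X : Type*} [NormedAddCommGroup X] [InnerProductSpace ℝ X] [CompleteSpace X]
    (u v : X) : riesz X u v = inner ℝ u v :=
  InnerProductSpace.toDual_apply_apply (𝕜 := ℝ)

section Nemytskii

variable {V W : Type*} [NormedAddCommGroup V] [NormedAddCommGroup W] {T : ℝ} {K : ℝ≥0}

/-- `f(t, u)` defines a `K`-Lipschitz Nemytskii operator from `L²(0, T; V)` to `L²(0, T; W)`. -/
structure IsLipschitzNemytskii (T : ℝ) (K : ℝ≥0) (f : ℝ → V → W) : Prop where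
  memLp : ∀ u : ℝ → V, MemLp u 2 (volume.restrict (Ioo 0 T)) →
    MemLp (fun t => f t (u t)) 2 (volume.restrict (Ioo 0 T))
  lipschitz : ∀ u v : ℝ → V, MemLp u 2 (volume.restrict (Ioo 0 T)) →
    MemLp v 2 (volume.restrict (Ioo 0 T)) →
    eLpNorm (fun t => f t (u t) - f t (v t)) 2 (volume.restrict (Ioo 0 T)) ≤
      K * eLpNorm (fun t => u t - v t) 2 (volume.restrict (Ioo 0 T))

theorem eLpNorm_two_sq {E : Type*} [NormedAddCommGroup E] (g : ℝ → E) (μ : Measure ℝ) :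
    eLpNorm g 2 μ ^ 2 = ∫⁻ t, ‖g t‖ₑ ^ 2 ∂μ := by
  rw [← ENNReal.rpow_natCast, eLpNorm_eq_lintegral_rpow_enorm_toReal (by norm_num) (by norm_num),
    ← ENNReal.rpow_mul]
  simp

/-- A Nemytskii operator that is Lipschitz in `L²` is Lipschitz almost everywhere: two functions
can be compared on any measurable set of times, being replaced by one of them elsewhere. -/
theorem IsLipschitzNemytskii.ae_norm_sub_le {f : ℝ → V → W} (hf : IsLipschitzNemytskii T K f)
    {u v : ℝ → V} (hu : MemLp u 2 (volume.restrict (Ioo 0 T)))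
    (hv : MemLp v 2 (volume.restrict (Ioo 0 T))) :
    ∀ᵐ t ∂(volume.restrict (Ioo 0 T)), ‖f t (u t) - f t (v t)‖ ≤ K * ‖u t - v t‖ := by
  have key : ∀ᵐ t ∂(volume.restrict (Ioo 0 T)),
      ‖f t (u t) - f t (v t)‖ₑ ^ 2 ≤ (K : ℝ≥0∞) ^ 2 * ‖u t - v t‖ₑ ^ 2 := by
    refine ae_le_of_forall_setLIntegral_le_of_sigmaFinite₀
      ((((hf.memLp u hu).sub (hf.memLp v hv)).aestronglyMeasurable.enorm).pow_const 2)
      fun s hs _ => ?_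
    classical
    have hw : MemLp (s.piecewise v u) 2 (volume.restrict (Ioo 0 T)) :=
      MemLp.piecewise hs (hv.restrict s) (hu.restrict sᶜ)
    have h := pow_le_pow_left₀ zero_le (hf.lipschitz u _ hu hw) 2
    rw [mul_pow, eLpNorm_two_sq, eLpNorm_two_sq, ← lintegral_const_mul' _ _ (by simp)] at h
    have h1 : ∀ g : ℝ → ℝ≥0∞, ∫⁻ t in Ioo 0 T, s.indicator g t =
        ∫⁻ t in s, g t ∂(volume.restrict (Ioo 0 T)) := fun g => lintegral_indicator hs g
    rw [← h1, ← h1]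
    refine le_trans (le_of_eq (lintegral_congr fun t => ?_))
      (h.trans (le_of_eq (lintegral_congr fun t => ?_)))
    all_goals
      by_cases ht : t ∈ s
      · simp [ht]
      · simp [ht]
  filter_upwards [key] with t ht
  rw [← mul_pow] at ht
  have h2 := (ENNReal.pow_le_pow_left_iff two_ne_zero).1 ht
  rw [← ofReal_norm, ← ofReal_norm, ← ENNReal.ofReal_coe_nnreal,
    ← ENNReal.ofReal_mul K.coe_nonneg] at h2
  exact (ENNReal.ofReal_le_ofReal_iff (by positivity)).1 h2

end Nemytskii

section Operator

variable {V : Type*} [NormedAddCommGroup V] [InnerProductSpace ℝ V] [CompleteSpace V]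
  {T : ℝ} {K : ℝ≥0} {f : ℝ → V → StrongDual ℝ V}

theorem IsLipschitzNemytskii.memLp_riesz (hf : IsLipschitzNemytskii T K f) {γ : ℝ}
    (u : Lp V 2 (expMeasure γ T)) :
    MemLp (fun t => (riesz V).symm (f t (u t))) 2 (expMeasure γ T) :=
  ((riesz V).symm.toContinuousLinearEquiv : StrongDual ℝ V →L[ℝ] V).comp_memLp'
    (memLp_expMeasure.2 (hf.memLp u (Lp_memLp_restrict u)))

/-- The Nemytskii operator of `f` on `L²(0, T; V)`, with values in `V*` read in `V`. -/
def nemytskii (hf : IsLipschitzNemytskii T K f) (γ : ℝ) (u : Lp V 2 (expMeasure γ T)) :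
    Lp V 2 (expMeasure γ T) :=
  (hf.memLp_riesz u).toLp _

theorem coeFn_nemytskii (hf : IsLipschitzNemytskii T K f) {γ : ℝ}
    (u : Lp V 2 (expMeasure γ T)) :
    nemytskii hf γ u =ᵐ[expMeasure γ T] fun t => (riesz V).symm (f t (u t)) :=
  MemLp.coeFn_toLp _

theorem norm_nemytskii_sub_le (hf : IsLipschitzNemytskii T K f) {γ : ℝ}
    (u v : Lp V 2 (expMeasure γ T)) :
    ‖nemytskii hf γ u - nemytskii hf γ v‖ ≤ K * ‖u - v‖ := by
  refine Lp.norm_le_mul_norm_of_ae_le_mul ?_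
  have h := hf.ae_norm_sub_le (Lp_memLp_restrict u) (Lp_memLp_restrict v)
  rw [← ae_expMeasure γ T] at h
  filter_upwards [h, coeFn_nemytskii hf u, coeFn_nemytskii hf v,
    Lp.coeFn_sub (nemytskii hf γ u) (nemytskii hf γ v), Lp.coeFn_sub u v] with t h1 h2 h3 h4 h5
  rw [h4, h5, Pi.sub_apply, Pi.sub_apply, h2, h3, ← map_sub, LinearIsometryEquiv.norm_map]
  exact h1

theorem norm_nemytskii_zero_sq_le (hf : IsLipschitzNemytskii T K f) {γ : ℝ} (hγ : 0 ≤ γ) :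
    ‖nemytskii hf γ 0‖ ^ 2 ≤ ∫ s in Ioo 0 T, ‖f s 0‖ ^ 2 := by
  have h : ∫ t, ‖nemytskii hf γ 0 t‖ ^ 2 ∂(expMeasure γ T) =
      ∫ t, ‖f t 0‖ ^ 2 ∂(expMeasure γ T) := by
    refine integral_congr_ae ?_
    filter_upwards [coeFn_nemytskii hf (0 : Lp V 2 (expMeasure γ T)),
      Lp.coeFn_zero V 2 (expMeasure γ T)] with t h1 h2
    rw [h1, LinearIsometryEquiv.norm_map, h2, Pi.zero_apply]
  rw [norm_sq_eq_integral, h]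
  exact integral_mono_measure (expMeasure_le hγ T) (ae_of_all _ fun t => by positivity)
    ((hf.memLp (fun _ => 0) MemLp.zero).integrable_norm_pow (by norm_num))

end Operator

/-! ### Weak derivatives in time and initial values -/

section TimeDerivative

theorem HasWeakDeriv.map {Y Z : Type*} [NormedAddCommGroup Y] [NormedSpace ℝ Y]
    [NormedAddCommGroup Z] [NormedSpace ℝ Z] {I : Set ℝ} {u w : ℝ → Y}
    (h : HasWeakDeriv I u w) (e : Y ≃ₗᵢ[ℝ] Z) :
    HasWeakDeriv I (fun t => e (u t)) (fun t => e (w t)) := by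
  intro φ hφ
  have h1 : ∀ (c : ℝ → ℝ) (g : ℝ → Y), ∫ x in I, c x • e (g x) = e (∫ x in I, c x • g x) := by
    intro c g
    have h2 := e.toContinuousLinearEquiv.integral_comp_comm (μ := volume.restrict I)
      (fun x => c x • g x)
    simpa using h2
  rw [h1, h1, h φ hφ, map_neg]

theorem HasWeakDeriv.congr_right {Y : Type*} [NormedAddCommGroup Y] [NormedSpace ℝ Y]
    {I : Set ℝ} {u w z : ℝ → Y} (h : HasWeakDeriv I u w)
    (hwz : w =ᵐ[volume.restrict I] z) : HasWeakDeriv I u z := by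
  intro φ hφ
  rw [h φ hφ]
  congr 1
  refine integral_congr_ae ?_
  filter_upwards [hwz] with x hx
  rw [hx]

variable {X : Type*} [NormedAddCommGroup X] [InnerProductSpace ℝ X] [CompleteSpace X] {γ T : ℝ}

omit [CompleteSpace X] in
theorem primitiveBCF_sub (w : Lp X 2 (expMeasure γ T)) {s t : ℝ} (hs : s ∈ Icc 0 T)
    (ht : t ∈ Icc 0 T) :
    primitiveBCF X γ T w t - primitiveBCF X γ T w s = ∫ r in s..t, w r := by
  rw [primitiveBCF_apply w hs, primitiveBCF_apply w ht, intervalIntegral.integral_interval_sub_left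
    (Lp_intervalIntegrable w ht) (Lp_intervalIntegrable w hs)]

theorem hasWeakDeriv_primitiveBCF (x₀ : X) (w : Lp X 2 (expMeasure γ T)) :
    HasWeakDeriv (Ioo 0 T) (fun t => x₀ + primitiveBCF X γ T w t) w := by
  refine hasWeakDeriv_of_sub_eq_integral isOpen_Ioo ordConnected_Ioo
    (Lp_integrableOn w).locallyIntegrableOn fun s hs t ht => ?_
  rw [add_sub_add_left_eq_sub,
    primitiveBCF_sub w (Ioo_subset_Icc_self hs) (Ioo_subset_Icc_self ht)]

theorem neBot_nhdsGT_inf_ae : (𝓝[>] (0 : ℝ) ⊓ ae volume).NeBot := by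
  rw [Filter.inf_neBot_iff]
  intro s hs t ht
  obtain ⟨ε, hε, h⟩ := mem_nhdsGT_iff_exists_Ioo_subset.1 hs
  have h1 : 0 < volume (Ioo (0 : ℝ) ε) := by simpa using hε
  have h2 : volume (Ioo (0 : ℝ) ε ∩ t) = volume (Ioo (0 : ℝ) ε) :=
    measure_inter_conull (mem_ae_iff.1 ht)
  obtain ⟨x, hx⟩ := nonempty_of_measure_ne_zero (by rw [h2]; exact h1.ne')
  exact ⟨x, h hx.1, hx.2⟩

theorem eventually_of_ae_restrict_Ioo {p : ℝ → Prop} (hT : 0 < T)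
    (h : ∀ᵐ t ∂(volume.restrict (Ioo 0 T)), p t) : ∀ᶠ t in 𝓝[>] (0 : ℝ) ⊓ ae volume, p t := by
  have h1 : ∀ᶠ t in 𝓝[>] (0 : ℝ) ⊓ ae volume, t ∈ Ioo 0 T :=
    (Ioo_mem_nhdsGT hT : Ioo 0 T ∈ 𝓝[>] (0 : ℝ)) |> mem_inf_of_left
  have h2 := (ae_restrict_iff' measurableSet_Ioo).1 h
  filter_upwards [h1, mem_inf_of_right h2] with t h3 h4
  exact h4 h3

theorem ae_eq_add_primitiveBCF (hT : 0 < T) {u : ℝ → X} {x₀ : X} (w : Lp X 2 (expMeasure γ T))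
    (hu : MemLp u 2 (volume.restrict (Ioo 0 T))) (h : HasWeakDeriv (Ioo 0 T) u w)
    (hlim : Tendsto u (𝓝[>] 0 ⊓ ae volume) (𝓝 x₀)) :
    ∀ᵐ t ∂(volume.restrict (Ioo 0 T)), u t = x₀ + primitiveBCF X γ T w t := by
  obtain ⟨C, hC⟩ := h.exists_ae_eq_add isOpen_Ioo ordConnected_Ioo (P := primitiveBCF X γ T w)
    (show IntegrableOn u (Ioo 0 T) volume from hu.integrable (by norm_num)).locallyIntegrableOn
    (Lp_integrableOn w).locallyIntegrableOn (primitiveBCF X γ T w).continuous.continuousOn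
    fun s hs t ht => primitiveBCF_sub w (Ioo_subset_Icc_self hs) (Ioo_subset_Icc_self ht)
  have h1 : Tendsto (fun t => C + primitiveBCF X γ T w t) (𝓝[>] 0 ⊓ ae volume) (𝓝 C) := by
    have h2 : Tendsto (fun t => C + primitiveBCF X γ T w t) (𝓝 0) (𝓝 (C + 0)) := by
      rw [← primitiveBCF_zero w]
      exact ((primitiveBCF X γ T w).continuous.tendsto 0).const_add C
    rw [add_zero] at h2
    exact h2.mono_left (inf_le_left.trans nhdsWithin_le_nhds)
  have := neBot_nhdsGT_inf_ae
  have hCx : C = x₀ := tendsto_nhds_unique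
    (h1.congr' ((eventually_of_ae_restrict_Ioo hT hC).mono fun t ht => ht.symm)) hlim
  rwa [← hCx]

end TimeDerivative

/-! ### Semilinear wave equations on a Gelfand triple -/

section GelfandTriple

variable {V H : Type*} [NormedAddCommGroup V] [InnerProductSpace ℝ V]
  [NormedAddCommGroup H] [InnerProductSpace ℝ H]

/-- The embedding `H → V*` of the Gelfand triple of `ι : V → H`. -/
def dualEmb (ι : V →L[ℝ] H) : H →L[ℝ] StrongDual ℝ V :=
  (innerSL ℝ (E := H)).bilinearComp (ContinuousLinearMap.id ℝ H) ι

/-- Weak solutions of `η'' + lam a η' + a η = f(t, η)`, `η(0) = u₀`, `η'(0) = v₀`, on the Gelfand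
triple of `ι : V → H`; the equation is one in `V*`, and the initial values are essential limits. -/
structure IsGelfandSolution (ι : V →L[ℝ] H) (a : V →L[ℝ] StrongDual ℝ V) (lam T : ℝ)
    (f : ℝ → V → StrongDual ℝ V) (u₀ : V) (v₀ : H)
    (η η' : ℝ → V) (η'' : ℝ → StrongDual ℝ V) : Prop where
  memLp : MemLp η 2 (volume.restrict (Ioo 0 T))
  memLp_deriv : MemLp η' 2 (volume.restrict (Ioo 0 T))
  memLp_deriv2 : MemLp η'' 2 (volume.restrict (Ioo 0 T))
  hasWeakDeriv : HasWeakDeriv (Ioo 0 T) η η'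
  hasWeakDeriv2 : HasWeakDeriv (Ioo 0 T) (fun t => dualEmb ι (ι (η' t))) η''
  equation : ∀ᵐ t ∂(volume.restrict (Ioo 0 T)), η'' t + lam • a (η' t) + a (η t) = f t (η t)
  initial : Tendsto η (𝓝[>] 0 ⊓ ae volume) (𝓝 u₀)
  initial_deriv : Tendsto (fun t => ι (η' t)) (𝓝[>] 0 ⊓ ae volume) (𝓝 v₀)

variable [CompleteSpace V] [CompleteSpace H] {ι : V →L[ℝ] H} {a : V →L[ℝ] StrongDual ℝ V}
  {lam T γ : ℝ} {K : ℝ≥0} {f : ℝ → V → StrongDual ℝ V} {u₀ : V} {v₀ : H}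

/-- An operator `V → V*`, read as an operator on `V`. -/
def rieszOp (a : V →L[ℝ] StrongDual ℝ V) : V →L[ℝ] V :=
  ((riesz V).symm.toContinuousLinearEquiv : StrongDual ℝ V →L[ℝ] V).comp a

theorem rieszOp_apply (u : V) : rieszOp a u = (riesz V).symm (a u) := rfl

theorem inner_rieszOp (u v : V) : inner ℝ (rieszOp a u) v = a u v := by
  rw [← riesz_apply, rieszOp_apply, LinearIsometryEquiv.apply_symm_apply]

theorem riesz_adjoint (ι : V →L[ℝ] H) (h : H) :
    riesz V (ContinuousLinearMap.adjoint ι h) = dualEmb ι h := by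
  ext v
  rw [riesz_apply, ContinuousLinearMap.adjoint_inner_left]
  rfl

variable {η η' : ℝ → V} {η'' : ℝ → StrongDual ℝ V}

/-- A weak solution satisfies the equation integrated in time, as an identity in `L²(0, T; V)`. -/
theorem IsGelfandSolution.integrated (hT : 0 < T) (hf : IsLipschitzNemytskii T K f)
    (hη : IsGelfandSolution ι a lam T f u₀ v₀ η η' η'') (γ : ℝ) :
    ∃ w : Lp V 2 (expMeasure γ T),
      (∀ᵐ t ∂(volume.restrict (Ioo 0 T)), η t = u₀ + primitiveBCF V γ T w t) ∧
      liftLp γ T (gram ι) w = constLp V γ T (ContinuousLinearMap.adjoint ι v₀) +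
        primitiveLp V γ T (nemytskii hf γ (constLp V γ T u₀ + primitiveLp V γ T w) -
          liftLp γ T (rieszOp a) (constLp V γ T u₀ + primitiveLp V γ T w) -
            lam • liftLp γ T (rieszOp a) w) := by
  have hw2 := memLp_expMeasure (γ := γ).2 hη.memLp_deriv
  set w := hw2.toLp η'
  have hw : w =ᵐ[expMeasure γ T] η' := hw2.coeFn_toLp
  have hg2 : MemLp (fun t => (riesz V).symm (η'' t)) 2 (expMeasure γ T) :=
    ((riesz V).symm.toContinuousLinearEquiv : StrongDual ℝ V →L[ℝ] V).comp_memLp'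
      (memLp_expMeasure.2 hη.memLp_deriv2)
  set g := hg2.toLp _
  have hg : g =ᵐ[expMeasure γ T] fun t => (riesz V).symm (η'' t) := hg2.coeFn_toLp
  have hw' : η' =ᵐ[volume.restrict (Ioo 0 T)] w := by
    rw [EventuallyEq, ← ae_expMeasure γ T]; exact hw.symm
  have hg' : (fun t => (riesz V).symm (η'' t)) =ᵐ[volume.restrict (Ioo 0 T)] g := by
    rw [EventuallyEq, ← ae_expMeasure γ T]; exact hg.symm
  have h1 := ae_eq_add_primitiveBCF hT w hη.memLp (hη.hasWeakDeriv.congr_right hw') hη.initial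
  have hd : ∀ t, (riesz V).symm (dualEmb ι (ι (η' t))) = gram ι (η' t) := by
    intro t
    rw [← riesz_adjoint, LinearIsometryEquiv.symm_apply_apply]
    rfl
  have h2 := hη.hasWeakDeriv2.map (riesz V).symm
  simp only [hd] at h2
  have h3 : Tendsto (fun t => gram ι (η' t)) (𝓝[>] 0 ⊓ ae volume)
      (𝓝 (ContinuousLinearMap.adjoint ι v₀)) :=
    ((ContinuousLinearMap.adjoint ι).continuous.tendsto v₀).comp hη.initial_deriv
  have h4 := ae_eq_add_primitiveBCF (u := fun t => gram ι (η' t)) hT g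
    ((gram ι).comp_memLp' hη.memLp_deriv) (h2.congr_right hg') h3
  refine ⟨w, h1, ?_⟩
  set ηL := constLp V γ T u₀ + primitiveLp V γ T w with hηL
  have h5 : ηL =ᵐ[expMeasure γ T] η := by
    rw [EventuallyEq, ← ae_expMeasure γ T] at *
    filter_upwards [h1, Lp.coeFn_add (constLp V γ T u₀) (primitiveLp V γ T w),
      coeFn_constLp (γ := γ) (T := T) u₀, coeFn_primitiveLp w] with t e1 e2 e3 e4
    rw [hηL, e2, Pi.add_apply, e3, e4, e1]
  have h6 : g = nemytskii hf γ ηL - liftLp γ T (rieszOp a) ηL -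
      lam • liftLp γ T (rieszOp a) w := by
    have he := hη.equation
    rw [← ae_expMeasure γ T] at he
    ext1
    filter_upwards [hg, h5, hw, he, coeFn_nemytskii hf ηL, coeFn_liftLp (rieszOp a) ηL,
      coeFn_liftLp (rieszOp a) w, Lp.coeFn_sub (nemytskii hf γ ηL - liftLp γ T (rieszOp a) ηL)
        (lam • liftLp γ T (rieszOp a) w), Lp.coeFn_sub (nemytskii hf γ ηL)
        (liftLp γ T (rieszOp a) ηL), Lp.coeFn_smul lam (liftLp γ T (rieszOp a) w)]
      with t e1 e2 e3 e4 e5 e6 e7 e8 e9 e10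
    rw [e8, Pi.sub_apply, e9, Pi.sub_apply, e10, Pi.smul_apply, e5, e6, e7, e1, e2, e3, ← e4,
      rieszOp_apply, rieszOp_apply, map_add, map_add, map_smul]
    abel
  rw [← h6]
  rw [← ae_expMeasure γ T] at h4
  ext1
  filter_upwards [h4, coeFn_liftLp (gram ι) w, hw, coeFn_primitiveLp g,
    coeFn_constLp (γ := γ) (T := T) (ContinuousLinearMap.adjoint ι v₀),
    Lp.coeFn_add (constLp V γ T (ContinuousLinearMap.adjoint ι v₀)) (primitiveLp V γ T g)]
    with t e1 e2 e3 e4 e5 e6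
  rw [e2, e3, e1, e6, Pi.add_apply, e4, e5]

/-- Conversely, a solution of the integrated equation whose velocity has a representative that is
continuous with values in `H` is a weak solution. -/
theorem isGelfandSolution_of_integrated (hT : 0 < T) (hf : IsLipschitzNemytskii T K f)
    {w : Lp V 2 (expMeasure γ T)} {W : BoundedContinuousFunction ℝ H}
    (hw : liftLp γ T (gram ι) w = constLp V γ T (ContinuousLinearMap.adjoint ι v₀) +
        primitiveLp V γ T (nemytskii hf γ (constLp V γ T u₀ + primitiveLp V γ T w) -
          liftLp γ T (rieszOp a) (constLp V γ T u₀ + primitiveLp V γ T w) -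
            lam • liftLp γ T (rieszOp a) w))
    (hW : W =ᵐ[expMeasure γ T] fun t => ι (w t)) (hW0 : W 0 = v₀) :
    ∃ η'' : ℝ → StrongDual ℝ V, IsGelfandSolution ι a lam T f u₀ v₀
      (fun t => u₀ + primitiveBCF V γ T w t) w η'' := by
  set ηL := constLp V γ T u₀ + primitiveLp V γ T w with hηL
  set g := nemytskii hf γ ηL - liftLp γ T (rieszOp a) ηL - lam • liftLp γ T (rieszOp a) w
  have h5 : ηL =ᵐ[expMeasure γ T] fun t => u₀ + primitiveBCF V γ T w t := by
    filter_upwards [Lp.coeFn_add (constLp V γ T u₀) (primitiveLp V γ T w),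
      coeFn_constLp (γ := γ) (T := T) u₀, coeFn_primitiveLp w] with t e2 e3 e4
    rw [hηL, e2, Pi.add_apply, e3, e4]
  refine ⟨fun t => riesz V (g t), ?_, Lp_memLp_restrict w, ?_, hasWeakDeriv_primitiveBCF u₀ w, ?_,
    ?_, ?_, ?_⟩
  · exact memLp_expMeasure.1 ((memLp_congr_ae h5).1 (Lp.memLp ηL))
  · exact ((riesz V).toContinuousLinearEquiv : V →L[ℝ] StrongDual ℝ V).comp_memLp'
      (Lp_memLp_restrict g)
  · refine ((hasWeakDeriv_primitiveBCF (ContinuousLinearMap.adjoint ι v₀) g).map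
      (riesz V)).congr_left ?_
    rw [EventuallyEq, ← ae_expMeasure γ T]
    filter_upwards [coeFn_liftLp (gram ι) w, coeFn_primitiveLp g,
      coeFn_constLp (γ := γ) (T := T) (ContinuousLinearMap.adjoint ι v₀),
      Lp.coeFn_add (constLp V γ T (ContinuousLinearMap.adjoint ι v₀)) (primitiveLp V γ T g)]
      with t e2 e4 e5 e6
    rw [← riesz_adjoint, ← e4]
    nth_rw 1 [← e5]
    rw [← Pi.add_apply, ← e6, ← hw, e2]
    rfl
  · rw [← ae_expMeasure γ T]
    filter_upwards [h5, coeFn_nemytskii hf ηL, coeFn_liftLp (rieszOp a) ηL,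
      coeFn_liftLp (rieszOp a) w, Lp.coeFn_sub (nemytskii hf γ ηL - liftLp γ T (rieszOp a) ηL)
        (lam • liftLp γ T (rieszOp a) w), Lp.coeFn_sub (nemytskii hf γ ηL)
        (liftLp γ T (rieszOp a) ηL), Lp.coeFn_smul lam (liftLp γ T (rieszOp a) w)]
      with t e2 e5 e6 e7 e8 e9 e10
    rw [e8, Pi.sub_apply, e9, Pi.sub_apply, e10, Pi.smul_apply, e5, e6, e7, e2, rieszOp_apply,
      rieszOp_apply, map_sub, map_sub, map_smul, LinearIsometryEquiv.apply_symm_apply,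
      LinearIsometryEquiv.apply_symm_apply, LinearIsometryEquiv.apply_symm_apply]
    abel
  · have h : Tendsto (fun t => u₀ + primitiveBCF V γ T w t) (𝓝 0) (𝓝 (u₀ + 0)) := by
      rw [← primitiveBCF_zero w]
      exact ((primitiveBCF V γ T w).continuous.tendsto 0).const_add u₀
    rw [add_zero] at h
    exact h.mono_left (inf_le_left.trans nhdsWithin_le_nhds)
  · rw [EventuallyEq, ae_expMeasure] at hW
    have h := W.continuous.tendsto 0
    rw [hW0] at h
    exact (h.mono_left (inf_le_left.trans nhdsWithin_le_nhds)).congr'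
      (eventually_of_ae_restrict_Ioo hT hW)

/-- Uniqueness of weak solutions. -/
theorem IsGelfandSolution.ae_eq (hT : 0 < T) (hγ : 0 < γ)
    (hA : ∀ u, lam * ‖u‖ ^ 2 ≤ γ * ‖ι u‖ ^ 2 + lam * a u u)
    {α : ℝ} (hα : 0 ≤ α) (haα : ∀ u, ‖a u‖ ≤ α * ‖u‖) (hsmall : K + α < lam * γ)
    (hf : IsLipschitzNemytskii T K f) {ζ ζ' : ℝ → V} {ζ'' : ℝ → StrongDual ℝ V}
    (hζ : IsGelfandSolution ι a lam T f u₀ v₀ ζ ζ' ζ'')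
    (hη : IsGelfandSolution ι a lam T f u₀ v₀ η η' η'') :
    ζ =ᵐ[volume.restrict (Ioo 0 T)] η := by
  obtain ⟨w, hw, hwe⟩ := hζ.integrated hT hf γ
  obtain ⟨z, hz, hze⟩ := hη.integrated hT hf γ
  set J := primitiveLp V γ T
  set p := constLp V γ T u₀ + J w with hp
  set q := constLp V γ T u₀ + J z with hq
  have hA' : ∀ u, lam * ‖u‖ ^ 2 ≤ γ * ‖ι u‖ ^ 2 + lam * inner ℝ (rieszOp a u) u := fun u => by
    rw [inner_rieszOp]; exact hA u
  have haα' : ∀ u, ‖rieszOp a u‖ ≤ α * ‖u‖ := fun u => by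
    rw [rieszOp_apply, LinearIsometryEquiv.norm_map]; exact haα u
  have hpq : p - q = J (w - z) := by
    rw [hp, hq, map_sub]
    abel
  have h0 : J (w - z) = 0 := by
    refine primitiveLp_eq_zero_of_eq hγ hT.le hA' hsmall
      (G := nemytskii hf γ p - nemytskii hf γ q - liftLp γ T (rieszOp a) (p - q)) ?_ ?_
    · rw [map_sub, hwe, hze, add_sub_add_left_eq_sub, ← map_sub]
      congr 1
      simp only [map_sub, smul_sub]
      abel
    · rw [hpq, add_mul]
      refine (norm_sub_le _ _).trans (add_le_add ?_ (norm_liftLp_le hα haα' _))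
      have h := norm_nemytskii_sub_le hf p q
      rwa [hpq] at h
  have h1 : primitiveLp V γ T w = primitiveLp V γ T z := by
    rw [map_sub] at h0
    exact sub_eq_zero.1 h0
  have h2 := coeFn_primitiveLp w
  have h3 := coeFn_primitiveLp z
  rw [EventuallyEq, ae_expMeasure] at h2 h3
  filter_upwards [hw, hz, h2, h3] with t e1 e2 e3 e4
  rw [e1, e2, ← e3, ← e4, h1]

end GelfandTriple

/-- The energy bound, from the bounds on velocity and position by the data: `x`, `y`, `z` are the
norms of `u₀`, `v₀`, `f(·, 0)` and `n`, `p`, `q`, `r` those of `η'` in `L²(0, T; V)`, of `η'(t)` in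
`H`, of `∫₀ᵗ η'` and of `η(t)` in `V`. -/
theorem energy_bound {c e T k x y z g2 n p q r I : ℝ} (hc : 0 ≤ c) (he : 0 ≤ e) (hT : 0 ≤ T)
    (hk : 0 ≤ k) (hx : 0 ≤ x) (hy : 0 ≤ y) (hz : 0 ≤ z) (hn0 : 0 ≤ n) (hp0 : 0 ≤ p) (hr0 : 0 ≤ r)
    (hg2 : z ^ 2 ≤ g2) (hn : n ≤ 2 * (c * (y + z + k * (√T * x))))
    (hp : p ≤ e * (2 * (c * (y + z + k * (√T * x))))) (hq : q ≤ e * √T * n) (hr : r ≤ x + q)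
    (hI : I ≤ e ^ 2 * n ^ 2) :
    p ^ 2 + r ^ 2 + I ≤ (e ^ 2 * (2 * c) ^ 2 * (3 * (1 + k * √T) ^ 2) * (2 + 2 * T) + 2) *
      (x ^ 2 + y ^ 2 + g2) := by
  set m := 1 + k * √T with hm
  have hkT : 0 ≤ k * √T := by positivity
  have hm1 : 1 ≤ m := by linarith
  set E := x ^ 2 + y ^ 2 + g2 with hE
  set D := y + z + k * (√T * x) with hD
  have hD0 : 0 ≤ D := by positivity
  have hDm : D ≤ m * (x + y + z) := by
    have h2 : m * (x + y + z) - D = x + k * √T * (y + z) := by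
      rw [hD, hm]; ring
    have h3 : 0 ≤ x + k * √T * (y + z) := by positivity
    linarith
  have hD2 : D ^ 2 ≤ 3 * m ^ 2 * E := by
    have h1 : (x + y + z) ^ 2 ≤ 3 * E := by
      rw [hE]
      nlinarith [sq_nonneg (x - y), sq_nonneg (x - z), sq_nonneg (y - z)]
    calc D ^ 2 ≤ (m * (x + y + z)) ^ 2 := by gcongr
      _ = m ^ 2 * (x + y + z) ^ 2 := by ring
      _ ≤ m ^ 2 * (3 * E) := by gcongr
      _ = 3 * m ^ 2 * E := by ring
  set B := e * (2 * (c * D)) with hB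
  have hB0 : 0 ≤ B := by positivity
  have hB2 : B ^ 2 ≤ e ^ 2 * (2 * c) ^ 2 * (3 * m ^ 2) * E := by
    calc B ^ 2 = e ^ 2 * (2 * c) ^ 2 * D ^ 2 := by rw [hB]; ring
      _ ≤ e ^ 2 * (2 * c) ^ 2 * (3 * m ^ 2 * E) := by gcongr
      _ = _ := by ring
  have hwB : e * n ≤ B := mul_le_mul_of_nonneg_left hn he
  have e1 : p ^ 2 ≤ B ^ 2 := pow_le_pow_left₀ hp0 hp 2
  have e2 : r ^ 2 ≤ 2 * x ^ 2 + 2 * (T * B ^ 2) := by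
    have h1 : q ≤ √T * B := by
      have h' := mul_le_mul_of_nonneg_left hwB (Real.sqrt_nonneg T)
      linarith
    have h3 := pow_le_pow_left₀ hr0 (hr.trans (add_le_add le_rfl h1)) 2
    have h4 : (√T * B) ^ 2 = T * B ^ 2 := by rw [mul_pow, Real.sq_sqrt hT]
    nlinarith [sq_nonneg (x - √T * B)]
  have e3 : I ≤ B ^ 2 := by
    rw [← mul_pow] at hI
    exact hI.trans (pow_le_pow_left₀ (by positivity) hwB 2)
  have hu : x ^ 2 ≤ E := by
    have := sq_nonneg y
    have := sq_nonneg z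
    rw [hE]; linarith
  have h5 := mul_le_mul_of_nonneg_right hB2 (by positivity : 0 ≤ 2 + 2 * T)
  calc _ ≤ B ^ 2 + (2 * x ^ 2 + 2 * (T * B ^ 2)) + B ^ 2 := by gcongr
    _ = B ^ 2 * (2 + 2 * T) + 2 * x ^ 2 := by ring
    _ ≤ e ^ 2 * (2 * c) ^ 2 * (3 * m ^ 2) * E * (2 + 2 * T) + 2 * E :=
        add_le_add h5 (by linarith)
    _ = _ := by ring

/-- Well-posedness of the semilinear wave equation with strong damping on a Gelfand triple, with an
energy estimate whose constant depends only on `lam`, `T`, the Lipschitz constant `K` of the forcing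
and the bound `α` of the operator. -/
theorem exists_gelfand_wellposed {lam T α : ℝ} (K : ℝ≥0) (hlam : 0 < lam) (hT : 0 < T)
    (hα : 0 ≤ α) :
    ∃ C : ℝ, ∀ (V H : Type) [NormedAddCommGroup V] [InnerProductSpace ℝ V] [CompleteSpace V]
      [NormedAddCommGroup H] [InnerProductSpace ℝ H] [CompleteSpace H]
      (ι : V →L[ℝ] H) (a : V →L[ℝ] StrongDual ℝ V), DenseRange ι →
      (∀ u, ‖u‖ ^ 2 ≤ ‖ι u‖ ^ 2 + a u u) → (∀ u, ‖a u‖ ≤ α * ‖u‖) →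
      ∀ f : ℝ → V → StrongDual ℝ V, IsLipschitzNemytskii T K f → ∀ (u₀ : V) (v₀ : H),
      ∃ (η η' : ℝ → V) (η'' : ℝ → StrongDual ℝ V) (w : ℝ → H),
        IsGelfandSolution ι a lam T f u₀ v₀ η η' η'' ∧
        (∀ᵐ t ∂(volume.restrict (Ioo 0 T)), w t = ι (η' t)) ∧
        (∀ (ζ ζ' : ℝ → V) (ζ'' : ℝ → StrongDual ℝ V),
          IsGelfandSolution ι a lam T f u₀ v₀ ζ ζ' ζ'' →
            ζ =ᵐ[volume.restrict (Ioo 0 T)] η) ∧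
        Continuous η ∧ η 0 = u₀ ∧ Continuous w ∧ w 0 = v₀ ∧
        ∀ t ∈ Icc 0 T,
          ‖w t‖ ^ 2 + ‖η t‖ ^ 2 + ∫ s in Ioo 0 t, ‖η' s‖ ^ 2 ≤
            C * (‖u₀‖ ^ 2 + ‖v₀‖ ^ 2 + ∫ s in Ioo 0 T, ‖f s 0‖ ^ 2) := by
  set c := lam⁻¹ + 1 with hc
  have hc0 : 0 < c := by positivity
  have hK : (0 : ℝ) ≤ K := K.coe_nonneg
  -- the weight has to beat `lam`, for coercivity, and the Lipschitz constants, for contraction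
  set γ := lam + 2 * (c * (K + α)) with hγdef
  have hγlam : lam ≤ γ := by
    have : 0 ≤ 2 * (c * (K + α)) := by positivity
    linarith
  have hγ : 0 < γ := hlam.trans_le hγlam
  have hsm : 2 * (c * (K + α)) ≤ γ := by linarith
  have hsm' : K + α < lam * γ := by
    have h1 : lam * c = 1 + lam := by rw [hc]; field_simp
    have h2 : lam * γ = lam ^ 2 + 2 * ((1 + lam) * (K + α)) := by
      rw [hγdef, ← h1]; ring
    rw [h2]
    nlinarith [mul_nonneg hlam.le (add_nonneg hK hα), pow_pos hlam 2]
  refine ⟨Real.exp (γ * T) ^ 2 * (2 * c) ^ 2 * (3 * (1 + (K + α) * √T) ^ 2) * (2 + 2 * T) + 2, ?_⟩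
  intro V H _ _ _ _ _ _ ι a hι ha haα f hf u₀ v₀
  have hA : ∀ u, lam * ‖u‖ ^ 2 ≤ γ * ‖ι u‖ ^ 2 + lam * a u u := by
    intro u
    have h1 := mul_le_mul_of_nonneg_left (ha u) hlam.le
    have h2 := mul_le_mul_of_nonneg_right hγlam (sq_nonneg ‖ι u‖)
    linarith
  have hA' : ∀ u, lam * ‖u‖ ^ 2 ≤ γ * ‖ι u‖ ^ 2 + lam * inner ℝ (rieszOp a u) u := fun u => by
    rw [inner_rieszOp]; exact hA u
  have haα' : ∀ u, ‖rieszOp a u‖ ≤ α * ‖u‖ := fun u => by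
    rw [rieszOp_apply, LinearIsometryEquiv.norm_map]; exact haα u
  obtain ⟨w, W, heq, hae, hW0, hwn, hWn⟩ := exists_semilinear_solution (T := T) hι hlam hγ hT.le
    hA' hα hK haα' hsm (norm_nemytskii_sub_le hf (γ := γ)) u₀ v₀
  obtain ⟨η'', hsol⟩ := isGelfandSolution_of_integrated hT hf heq hae hW0
  refine ⟨_, w, η'', W, hsol, ?_, fun ζ ζ' ζ'' hζ => hζ.ae_eq hT hγ hA hα haα hsm' hf hsol, ?_, ?_,
    W.continuous, hW0, ?_⟩
  · rwa [EventuallyEq, ae_expMeasure] at hae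
  · exact continuous_const.add (primitiveBCF V γ T w).continuous
  · rw [primitiveBCF_zero, add_zero]
  intro t ht
  rw [abs_of_pos hT] at hwn hWn
  refine energy_bound hc0.le (Real.exp_pos _).le hT.le (add_nonneg hK hα) (norm_nonneg u₀)
    (norm_nonneg v₀) (norm_nonneg (nemytskii hf γ 0)) (norm_nonneg w) (norm_nonneg _)
    (norm_nonneg _) (norm_nemytskii_zero_sq_le hf hγ.le) hwn (hWn t)
    (q := ‖primitiveBCF V γ T w t‖) ?_ (norm_add_le _ _) ?_
  · have h := norm_primitiveBCF_apply_le w t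
    rwa [abs_of_pos hT, abs_of_pos hγ] at h
  · have h1 : ∫ s in Ioo 0 t, ‖w s‖ ^ 2 ≤ ∫ s in Ioo 0 T, ‖w s‖ ^ 2 :=
      setIntegral_mono_set ((Lp_memLp_restrict w).integrable_norm_pow (by norm_num))
        (ae_of_all _ fun s => by positivity) (Ioo_subset_Ioo_right ht.2).eventuallyLE
    have h2 := setIntegral_norm_sq_le w
    rw [abs_of_pos hT, abs_of_pos hγ] at h2
    refine h1.trans (h2.trans (le_of_eq ?_))
    rw [← Real.exp_nat_mul]
    norm_num

/-! ### The spaces `H¹₀` and `H¹_N` on an interval -/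

section Spaces

variable {L : EReal}

theorem interval_eq_preimage (L : EReal) :
    interval L = ((↑) : ℝ → EReal) ⁻¹' Ioo (-L) L := rfl

theorem isOpen_interval (L : EReal) : IsOpen (interval L) :=
  isOpen_Ioo.preimage continuous_coe_real_ereal

theorem ordConnected_interval (L : EReal) : (interval L).OrdConnected := by
  rw [interval_eq_preimage]
  exact ordConnected_Ioo.preimage_mono EReal.coe_strictMono.monotone

theorem zero_mem_interval (hL : 0 < L) : (0 : ℝ) ∈ interval L := by
  refine ⟨?_, by simpa using hL⟩
  rw [EReal.coe_zero, EReal.neg_lt_comm, neg_zero]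
  exact hL

theorem IsTestFunction.hasWeakDeriv {φ : ℝ → ℝ} (hφ : IsTestFunction (interval L) φ) :
    HasWeakDeriv (interval L) φ (_root_.deriv φ) := by
  have hc : Continuous (_root_.deriv φ) := hφ.smooth.continuous_deriv (by simp)
  refine hasWeakDeriv_of_sub_eq_integral (isOpen_interval L) (ordConnected_interval L)
    (hc.locallyIntegrable.locallyIntegrableOn _) fun x _ y _ => ?_
  exact (intervalIntegral.integral_deriv_eq_sub
    (fun z _ => hφ.smooth.differentiable (by simp) z) (hc.intervalIntegrable _ _)).symm

theorem testPairs_le_H1 : testPairs L ≤ H1 L := by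
  rintro p ⟨φ, hφ, h1, h2⟩
  exact (hφ.hasWeakDeriv.congr_left h1.symm).congr_right h2.symm

theorem testPairs_le_neumannPairs : testPairs L ≤ neumannPairs L := by
  rintro p ⟨φ, hφ, h1, h2⟩
  refine ⟨testPairs_le_H1 ⟨φ, hφ, h1, h2⟩, _root_.deriv φ,
    (hφ.smooth.continuous_deriv (by simp)).continuousOn, h2, fun x hx => ?_⟩
  refine image_eq_zero_of_notMem_tsupport fun h => ?_
  rw [(isOpen_interval L).frontier_eq] at hx
  exact hx.2 (hφ.deriv.support h)

theorem isClosed_H1 : IsClosed (H1 L : Set (HxH L)) := by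
  have h : (H1 L : Set (HxH L)) = ⋂ (φ : ℝ → ℝ) (hφ : IsTestFunction (interval L) φ),
      {p : HxH L | inner ℝ ((hφ.memLp_deriv (volume.restrict (interval L))).toLp _) p.fst =
        -inner ℝ ((hφ.memLp (volume.restrict (interval L))).toLp _) p.snd} := by
    have key : ∀ {ψ : ℝ → ℝ} (hψ : MemLp ψ 2 (volume.restrict (interval L))) (u : H L),
        inner ℝ (hψ.toLp ψ) u = ∫ x in interval L, ψ x • u x := by
      intro ψ hψ u
      rw [L2.inner_def]
      refine integral_congr_ae ?_
      filter_upwards [hψ.coeFn_toLp] with x hx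
      rw [hx, real_inner_eq_re_inner ℝ]
      simp [mul_comm]
    ext p
    simp only [mem_iInter, mem_ofPred_eq, key]
    rfl
  rw [h]
  refine isClosed_iInter fun φ => isClosed_iInter fun hφ => isClosed_eq ?_ ?_
  · exact continuous_const.inner (WithLp.fstL 2 ℝ (H L) (H L)).continuous
  · exact (continuous_const.inner (WithLp.sndL 2 ℝ (H L) (H L)).continuous).neg

variable {V : Submodule ℝ (HxH L)}

theorem isClosed_of_eq (hV : V = H10 L ∨ V = H1N L) : IsClosed (V : Set (HxH L)) := by
  rcases hV with rfl | rfl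
  · exact (testPairs L).isClosed_topologicalClosure
  · exact (neumannPairs L).isClosed_topologicalClosure

theorem testPairs_le_of_eq (hV : V = H10 L ∨ V = H1N L) : testPairs L ≤ V := by
  rcases hV with rfl | rfl
  · exact (testPairs L).le_topologicalClosure
  · exact testPairs_le_neumannPairs.trans (neumannPairs L).le_topologicalClosure

theorem le_H1_of_eq (hV : V = H10 L ∨ V = H1N L) : V ≤ H1 L := by
  rcases hV with rfl | rfl
  · exact Submodule.topologicalClosure_minimal _ testPairs_le_H1 isClosed_H1
  · exact Submodule.topologicalClosure_minimal _ (fun p hp => hp.1) isClosed_H1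

theorem Lp_locallyIntegrableOn {I : Set ℝ} (u : Lp ℝ 2 (volume.restrict I)) :
    LocallyIntegrableOn u I :=
  locallyIntegrableOn_of_locallyIntegrable_restrict ((Lp.memLp u).locallyIntegrable (by norm_num))

/-- `V` is dense in `L²`, because the test functions are. -/
theorem denseRange_toH (hV : testPairs L ≤ V) : DenseRange (toH V) := by
  change Dense ((LinearMap.range (toH V).toLinearMap : Submodule ℝ (H L)) : Set (H L))
  rw [Submodule.dense_iff_topologicalClosure_eq_top, Submodule.topologicalClosure_eq_top_iff,
    Submodule.eq_bot_iff]
  intro h hh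
  have key : ∀ φ : ℝ → ℝ, IsTestFunction (interval L) φ → ∫ x in interval L, φ x • h x = 0 := by
    intro φ hφ
    set p : HxH L := WithLp.toLp 2 ((hφ.memLp (volume.restrict (interval L))).toLp φ,
      (hφ.memLp_deriv (volume.restrict (interval L))).toLp (_root_.deriv φ))
    have hp : p ∈ testPairs L := ⟨φ, hφ,
      (hφ.memLp (volume.restrict (interval L))).coeFn_toLp,
      (hφ.memLp_deriv (volume.restrict (interval L))).coeFn_toLp⟩
    have h1 := (Submodule.mem_orthogonal _ _).1 hh _ ⟨⟨p, hV hp⟩, rfl⟩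
    have h2 : toH V ⟨p, hV hp⟩ = (hφ.memLp (volume.restrict (interval L))).toLp φ := rfl
    rw [ContinuousLinearMap.coe_coe, h2, L2.inner_def] at h1
    rw [← h1]
    refine integral_congr_ae ?_
    filter_upwards [(hφ.memLp (volume.restrict (interval L))).coeFn_toLp] with x hx
    rw [hx]
    simp [mul_comm]
  have h0 := (isOpen_interval L).ae_eq_zero_of_integral_contDiff_smul_eq_zero (μ := volume)
    (Lp_locallyIntegrableOn h) fun g h1 h2 h3 => by
      rw [← key g ⟨h1, h2, h3⟩]
      refine (setIntegral_eq_integral_of_forall_compl_eq_zero fun x hx => ?_).symm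
      rw [image_eq_zero_of_notMem_tsupport fun hx' => hx (h3 hx'), zero_smul]
  ext1
  refine EventuallyEq.trans ?_ (Lp.coeFn_zero _ _ _).symm
  rw [EventuallyEq, ae_restrict_iff' (isOpen_interval L).measurableSet]
  exact h0

theorem norm_sq_eq_toH_add_dx (u : V) : ‖u‖ ^ 2 = ‖toH V u‖ ^ 2 + ‖dx V u‖ ^ 2 :=
  WithLp.prod_norm_sq_eq_of_L2 (u : HxH L)

theorem norm_toH_le (u : V) : ‖toH V u‖ ≤ ‖u‖ :=
  le_of_sq_le_sq (by rw [norm_sq_eq_toH_add_dx]; linarith [sq_nonneg ‖dx V u‖]) (norm_nonneg u)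

theorem norm_dx_le (u : V) : ‖dx V u‖ ≤ ‖u‖ :=
  le_of_sq_le_sq (by rw [norm_sq_eq_toH_add_dx]; linarith [sq_nonneg ‖toH V u‖]) (norm_nonneg u)

theorem opA_apply (κ : ℝ) (u v : V) :
    opA V κ u v = inner ℝ (dx V u) (dx V v) + κ * inner ℝ (toH V u) (toH V v) := rfl

theorem norm_sq_le_add_opA {κ : ℝ} (hκ : 0 ≤ κ) (u : V) :
    ‖u‖ ^ 2 ≤ ‖toH V u‖ ^ 2 + opA V κ u u := by
  rw [opA_apply, real_inner_self_eq_norm_sq, real_inner_self_eq_norm_sq, norm_sq_eq_toH_add_dx]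
  linarith [mul_nonneg hκ (sq_nonneg ‖toH V u‖)]

theorem norm_opA_apply_le {κ : ℝ} (hκ : 0 ≤ κ) (u : V) : ‖opA V κ u‖ ≤ (1 + κ) * ‖u‖ := by
  refine ContinuousLinearMap.opNorm_le_bound (opA V κ u) (by positivity) fun v => ?_
  rw [opA_apply]
  have h1 : ‖inner ℝ (dx V u) (dx V v)‖ ≤ ‖u‖ * ‖v‖ :=
    (norm_inner_le_norm (dx V u) (dx V v)).trans
      (mul_le_mul (norm_dx_le u) (norm_dx_le v) (norm_nonneg _) (norm_nonneg _))
  have h2 : ‖inner ℝ (toH V u) (toH V v)‖ ≤ ‖u‖ * ‖v‖ :=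
    (norm_inner_le_norm (toH V u) (toH V v)).trans
      (mul_le_mul (norm_toH_le u) (norm_toH_le v) (norm_nonneg _) (norm_nonneg _))
  refine (norm_add_le _ _).trans ?_
  rw [norm_mul, Real.norm_of_nonneg hκ]
  nlinarith [mul_le_mul_of_nonneg_left h2 hκ]

end Spaces

/-! ### Point evaluation and point forcing -/

section Evaluation

variable {L : EReal} {V : Submodule ℝ (HxH L)}

theorem Ioo_subset_interval {b x : ℝ} (hb : b ∈ interval L) (hx : x ∈ closure (interval L)) :
    Ioo (min b x) (max b x) ⊆ interval L := by
  have hi := (isOpen_interval L).interior_eq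
  have hc : Convex ℝ (interval L) := (ordConnected_interval L).convex
  have h : openSegment ℝ b x ⊆ interval L := by
    have := hc.openSegment_interior_closure_subset_interior (x := b) (y := x) (by rwa [hi]) hx
    rwa [hi] at this
  rcases lt_trichotomy b x with h1 | h1 | h1
  · rwa [min_eq_left h1.le, max_eq_right h1.le, ← openSegment_eq_Ioo h1]
  · simp [h1]
  · rwa [min_eq_right h1.le, max_eq_left h1.le, ← openSegment_eq_Ioo h1, openSegment_symm]

/-- Point evaluation is bounded on `H¹` of an interval, up to the boundary. With a second point
`b` of the interval, integration of `((s - b) u)'` gives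
`(x₀ - b) u(x₀) = ∫ s in b..x₀, (u(s) + (s - b) u'(s))`, which is bounded in `u` and in `u'`. -/
theorem exists_evaluation (hL : 0 < L) (hV : V ≤ H1 L) {x₀ : ℝ}
    (hx₀ : x₀ ∈ closure (interval L)) :
    ∃ δ : StrongDual ℝ V, ∀ v : V, HasValueAt V v x₀ (δ v) := by
  obtain ⟨b, hb, hbx⟩ : ∃ b ∈ interval L, b ≠ x₀ := by
    by_contra! hcon
    have h1 : interval L ⊆ {x₀} := fun x hx => hcon x hx
    have h2 := (isOpen_interval L).measure_pos volume ⟨0, zero_mem_interval hL⟩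
    exact h2.ne' (measure_mono_null h1 (measure_singleton x₀))
  set S := Ioo (min b x₀) (max b x₀) with hS
  have hSI : S ⊆ interval L := Ioo_subset_interval hb hx₀
  have hSm : MeasurableSet S := measurableSet_Ioo
  have hk : ∀ g : ℝ → ℝ, Continuous g →
      MemLp (S.indicator g) 2 (volume.restrict (interval L)) := by
    intro g hg
    have h1 : MemLp g 2 (volume.restrict (Icc (min b x₀) (max b x₀))) :=
      by
      obtain ⟨C, hC⟩ := isCompact_Icc.exists_bound_of_continuousOn hg.continuousOn
      refine MemLp.of_bound hg.aestronglyMeasurable C ?_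
      filter_upwards [ae_restrict_mem measurableSet_Icc] with s hs using hC s hs
    refine MemLp.restrict _ ?_
    rw [memLp_indicator_iff_restrict hSm]
    exact h1.mono_measure (Measure.restrict_mono Ioo_subset_Icc_self le_rfl)
  have hkint : ∀ (g : ℝ → ℝ) (hg : Continuous g) (u : H L),
      inner ℝ ((hk g hg).toLp _) u = ∫ s in S, g s * u s := by
    intro g hg u
    rw [L2.inner_def, ← integral_indicator hSm, ← setIntegral_eq_integral_of_forall_compl_eq_zero
      (s := interval L) (fun x hx => indicator_of_notMem (fun h => hx (hSI h)) _)]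
    refine integral_congr_ae ?_
    filter_upwards [(hk g hg).coeFn_toLp] with s hs
    rw [hs]
    by_cases h : s ∈ S
    · simp [h, mul_comm]
    · simp [h]
  have hkI : ∀ (g : ℝ → ℝ) (_ : Continuous g) (u : H L),
      Integrable (fun s => g s * u s) (volume.restrict S) := by
    intro g hg u
    have h1 : IntegrableOn (fun s => S.indicator g s * u s) S :=
      IntegrableOn.mono_set ((hk g hg).integrable_mul (Lp.memLp u)) hSI
    refine h1.congr_fun (fun s hs => ?_) hSm
    simp only [indicator_of_mem hs]
  set ε : ℝ := if b ≤ x₀ then 1 else -1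
  set δ : StrongDual ℝ V := ((x₀ - b)⁻¹ * ε) •
    ((innerSL ℝ ((hk (fun _ => 1) continuous_const).toLp _)).comp (toH V) +
      (innerSL ℝ ((hk (fun s => s - b) (by fun_prop)).toLp _)).comp (dx V)) with hδ
  refine ⟨δ, fun v => ?_⟩
  set w : ℝ → ℝ := (interval L).indicator (dx V v) with hw
  have hwl : LocallyIntegrable w :=
    ((memLp_indicator_iff_restrict (isOpen_interval L).measurableSet).2
      (Lp.memLp (dx V v))).locallyIntegrable (by norm_num)
  have hwi : ∀ s t, IntervalIntegrable w volume s t := fun s t =>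
    (hwl.integrableOn_isCompact isCompact_uIcc).intervalIntegrable
  have hww : dx V v =ᵐ[volume.restrict (interval L)] w := by
    filter_upwards [ae_restrict_mem (isOpen_interval L).measurableSet] with s hs
    rw [hw, indicator_of_mem hs]
  have hPc : Continuous fun x => ∫ s in b..x, w s := intervalIntegral.continuous_primitive hwi b
  have hweak : HasWeakDeriv (interval L) (toH V v) w :=
    HasWeakDeriv.congr_right (show HasWeakDeriv (interval L) (toH V v) (dx V v) from hV v.2) hww
  obtain ⟨C, hC⟩ := hweak.exists_ae_eq_add (isOpen_interval L) (ordConnected_interval L)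
    (Lp_locallyIntegrableOn _) (hwl.locallyIntegrableOn _) hPc.continuousOn
    fun x _ y _ => intervalIntegral.integral_interval_sub_left (hwi _ _) (hwi _ _)
  refine ⟨fun x => C + ∫ s in b..x, w s, (continuous_const.add hPc).continuousOn, hC, ?_⟩
  have hparts := integral_deriv_smul_primitive (φ := fun s => s - b) (by fun_prop) (hwi b x₀)
    left_mem_uIcc C
  simp only [deriv_sub_const, deriv_id'', smul_eq_mul, one_mul, sub_self, zero_mul, sub_zero]
    at hparts
  have hset : ∫ s in b..x₀, (C + (∫ r in b..s, w r) + (s - b) * w s) =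
      ε * ((∫ s in S, 1 * toH V v s) + ∫ s in S, (s - b) * dx V v s) := by
    rw [intervalIntegral.intervalIntegral_eq_integral_uIoc, smul_eq_mul, uIoc,
      integral_Ioc_eq_integral_Ioo, ← integral_add]
    · congr 1
      refine setIntegral_congr_ae hSm ?_
      have h1 := (ae_restrict_iff' (isOpen_interval L).measurableSet).1 hC
      have h2 := (ae_restrict_iff' (isOpen_interval L).measurableSet).1 hww
      filter_upwards [h1, h2] with s h3 h4 hs
      rw [h3 (hSI hs), h4 (hSI hs), one_mul]
    · exact hkI _ continuous_const _
    · exact hkI _ (by fun_prop) _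
  have hδv : δ v = (x₀ - b)⁻¹ * ε *
      ((∫ s in S, 1 * toH V v s) + ∫ s in S, (s - b) * dx V v s) := by
    rw [← hkint (fun _ => 1) continuous_const, ← hkint (fun s => s - b) (by fun_prop)]
    rfl
  rw [hδv, mul_assoc, ← hset, hparts, ← mul_assoc, inv_mul_cancel₀ (sub_ne_zero.2 hbx.symm),
    one_mul]

end Evaluation

section SineForcing

theorem isLipschitzNemytskii_sin_smul {V : Type*} [NormedAddCommGroup V] [NormedSpace ℝ V]
    (δ : StrongDual ℝ V) (T : ℝ) :
    IsLipschitzNemytskii T (‖δ‖₊ ^ 2) (fun _ w => Real.sin (δ w) • δ) := by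
  have hlip : ∀ u v : V, ‖Real.sin (δ u) • δ - Real.sin (δ v) • δ‖ ≤ ‖δ‖ ^ 2 * ‖u - v‖ := by
    intro u v
    have h1 : ‖Real.sin (δ u) - Real.sin (δ v)‖ ≤ ‖δ (u - v)‖ := by
      simpa [dist_eq_norm] using Real.lipschitzWith_sin.dist_le_mul (δ u) (δ v)
    have h2 : Real.sin (δ u) • δ - Real.sin (δ v) • δ = (Real.sin (δ u) - Real.sin (δ v)) • δ :=
      (sub_smul _ _ _).symm
    rw [h2, norm_smul, pow_two, mul_comm, mul_assoc]
    exact mul_le_mul_of_nonneg_left (h1.trans (δ.le_opNorm _)) (norm_nonneg δ)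
  refine ⟨fun u hu => ?_, fun u v hu hv => ?_⟩
  · have hc : Continuous fun w : V => Real.sin (δ w) • δ := by fun_prop
    refine MemLp.of_le_mul (c := ‖δ‖ ^ 2) hu
      (hc.comp_aestronglyMeasurable hu.aestronglyMeasurable) (ae_of_all _ fun t => ?_)
    simpa using hlip (u t) 0
  · have h := eLpNorm_le_nnreal_smul_eLpNorm_of_ae_le_mul (μ := volume.restrict (Ioo 0 T))
      (f := fun t => Real.sin (δ (u t)) • δ - Real.sin (δ (v t)) • δ) (g := fun t => u t - v t)
      (c := ‖δ‖₊ ^ 2) (ae_of_all _ fun t => by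
        rw [← NNReal.coe_le_coe]
        simpa using hlip (u t) (v t)) 2
    simpa [ENNReal.smul_def] using h

end SineForcing

/-! ### The equation on the interval -/

section Application

variable {L : EReal} {V : Submodule ℝ (HxH L)} {κ lam T : ℝ} {f : ℝ → V → StrongDual ℝ V}
  {u₀ : V} {v₀ : H L} {η η' : ℝ → V} {η'' : ℝ → StrongDual ℝ V}

theorem isWeakSolution_iff_isGelfandSolution :
    IsWeakSolution V κ lam T f u₀ v₀ η η' η'' ↔
      IsGelfandSolution (toH V) (opA V κ) lam T f u₀ v₀ η η' η'' :=
  ⟨fun h => ⟨h.memLp, h.memLp_deriv, h.memLp_deriv2, h.hasWeakDeriv, h.hasWeakDeriv2, h.equation,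
      h.initial, h.initial_deriv⟩,
    fun h => ⟨h.memLp, h.memLp_deriv, h.memLp_deriv2, h.hasWeakDeriv, h.hasWeakDeriv2, h.equation,
      h.initial, h.initial_deriv⟩⟩

theorem isLipschitzForcing_iff_isLipschitzNemytskii {K : ℝ≥0} :
    IsLipschitzForcing V T K f ↔ IsLipschitzNemytskii T K f :=
  ⟨fun h => ⟨h.memLp, h.lipschitz⟩, fun h => ⟨h.memLp, h.lipschitz⟩⟩

end Application

end

end SineGordon

theorem theorem2 :
    (∀ (lam T κ : ℝ) (K : ℝ≥0), 0 < lam → 0 < T → 0 ≤ κ →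
      ∃ C : ℝ, ∀ L : EReal, 0 < L →
        ∀ V : Submodule ℝ (SineGordon.HxH L), V = SineGordon.H10 L ∨ V = SineGordon.H1N L →
        ∀ f : ℝ → V → StrongDual ℝ V, SineGordon.IsLipschitzForcing V T K f →
        ∀ (u₀ : V) (v₀ : SineGordon.H L),
          ∃ (η η' : ℝ → V) (η'' : ℝ → StrongDual ℝ V) (w : ℝ → SineGordon.H L),
            -- `η` is a weak solution, and `w` is `η'` up to a null set
            SineGordon.IsWeakSolution V κ lam T f u₀ v₀ η η' η'' ∧
            (∀ᵐ t ∂(volume.restrict (Ioo 0 T)), w t = SineGordon.toH V (η' t)) ∧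
            -- every weak solution is equal to `η`
            (∀ (ζ ζ' : ℝ → V) (ζ'' : ℝ → StrongDual ℝ V),
              SineGordon.IsWeakSolution V κ lam T f u₀ v₀ ζ ζ' ζ'' →
                ζ =ᵐ[volume.restrict (Ioo 0 T)] η) ∧
            -- regularity: `η ∈ C([0,T];V)`, `η' ∈ C([0,T];H)`, `η'' ∈ L²(0,T;V*)`
            ContinuousOn η (Icc 0 T) ∧ η 0 = u₀ ∧
            ContinuousOn w (Icc 0 T) ∧ w 0 = v₀ ∧
            MemLp η'' 2 (volume.restrict (Ioo 0 T)) ∧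
            -- energy estimate, with `g = f(·, 0)`
            ∀ t ∈ Icc 0 T,
              ‖w t‖ ^ 2 + ‖η t‖ ^ 2 + ∫ s in Ioo 0 t, ‖η' s‖ ^ 2 ≤
                C * (‖u₀‖ ^ 2 + ‖v₀‖ ^ 2 + ∫ s in Ioo 0 T, ‖f s 0‖ ^ 2)) ∧
    -- the point forcing `δ(x - x₀) sin η` is an admissible `f`
    (∀ L : EReal, 0 < L →
      ∀ V : Submodule ℝ (SineGordon.HxH L), V = SineGordon.H10 L ∨ V = SineGordon.H1N L →
      ∀ x₀ ∈ closure (SineGordon.interval L),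
        ∃ δ : StrongDual ℝ V, (∀ v : V, SineGordon.HasValueAt V v x₀ (δ v)) ∧
          ∃ K : ℝ≥0, ∀ T : ℝ, 0 < T →
            SineGordon.IsLipschitzForcing V T K (fun _ w => Real.sin (δ w) • δ)) := by
  refine ⟨fun lam T κ K hlam hT hκ => ?_, fun L hL V hV x₀ hx₀ => ?_⟩
  · have hα : (0 : ℝ) ≤ 1 + κ := by positivity
    obtain ⟨C, hC⟩ := SineGordon.exists_gelfand_wellposed K hlam hT hα
    refine ⟨C, fun L _ V hV f hf u₀ v₀ => ?_⟩
    have : CompleteSpace V := (SineGordon.isClosed_of_eq hV).completeSpace_coe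
    obtain ⟨η, η', η'', w, hsol, hw, huniq, hη, hη0, hwc, hw0, hen⟩ :=
      hC V (SineGordon.H L) (SineGordon.toH V) (SineGordon.opA V κ)
        (SineGordon.denseRange_toH (SineGordon.testPairs_le_of_eq hV))
        (SineGordon.norm_sq_le_add_opA hκ) (SineGordon.norm_opA_apply_le hκ) f
        (SineGordon.isLipschitzForcing_iff_isLipschitzNemytskii.1 hf) u₀ v₀
    exact ⟨η, η', η'', w, SineGordon.isWeakSolution_iff_isGelfandSolution.2 hsol, hw,
      fun ζ ζ' ζ'' hζ => huniq ζ ζ' ζ'' (SineGordon.isWeakSolution_iff_isGelfandSolution.1 hζ),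
      hη.continuousOn, hη0, hwc.continuousOn, hw0, hsol.memLp_deriv2, hen⟩
  · obtain ⟨δ, hδ⟩ := SineGordon.exists_evaluation hL (SineGordon.le_H1_of_eq hV) hx₀
    exact ⟨δ, hδ, ‖δ‖₊ ^ 2, fun T _ => SineGordon.isLipschitzForcing_iff_isLipschitzNemytskii.2
      (SineGordon.isLipschitzNemytskii_sin_smul δ T)⟩
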